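/- Let $r\ge 1$. A finite $\Sigma$-labeled $r$-relational digraph $G=(V,(E_k)_{1\le k\le r},\lambda)$ has a finite nonempty node set $V$, edge sets $E_k\subseteq V\times V$ and a labeling $\lambda:V\to\Sigma$, where $\Sigma$ is a finite set. A distributed automaton $A=(Q,q_0,(\delta_a)_{a\in\Sigma},F)$ over such digraphs has a finite nonempty state set $Q$, an initial state $q_0\in Q$, transition functions $\delta_a:Q\times(2^Q)^r\to Q$ and accepting states $F\subseteq Q$. Its run on $G$ is given by $\rho_0(v)=q_0$ and $$\rho_{t+1}(v)=\delta_{\lambda(v)}\bigl(\rho_t(v),(\{\rho_t(u): uv\in E_k\})_{1\le k\le r}\bigr),$$ and $A$ accepts the pointed digraph $(G,v)$ if $\rho_t(v)\in F$ for some $t\in\mathbb N$. The automaton is forgetful if $\delta_a(q,\vec N)=\delta_a(q',\vec N)$ for all $a\in\Sigma$, $q,q'\in Q$ and $\vec N\in(2^Q)^r$, so that $\delta_a$ can be regarded as a function $(2^Q)^r\to Q$. A forgetful automaton with $\Sigma=\{0,\dots,s-1\}$ and $Q=\{0,\dots,n-1\}$ is encoded, without compression, by the binary word that consists of $s$, $r$,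 $n$ in unary, the initial state, a bit array for $F$, and, for each $a\in\Sigma$, a lookup table listing the states $\delta_a(\vec N)$ for all $\vec N\in(2^Q)^r$, each state being written in binary with a fixed number $\lfloor\log_2 n\rfloor+1$ of bits. Theorem. The emptiness problem for forgetful distributed automata is decidable in LogSpace: the set of the encodings of those forgetful distributed automata (with arbitrary $\Sigma$, $r\geq 1$ and $Q$) that accept at least one pointed digraph is decided by a deterministic Turing machine that has a two-way read-only input tape and finitely many work tapes, halts on every binary word $x$, and visits $O(1+\log(1+|x|))$ work tape cells on it. -/

import Mathlib

namespace DistAut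

/-! ### Labeled digraphs -/

/-- A finite nonempty `Sym`-labeled, `r`-relational directed graph.
`edge k u v` says that `u` is an incoming `k`-neighbor of `v`. -/
structure LabeledDigraph (Sym : Type) (r : ℕ) where
  Node : Type
  finite : Finite Node
  nonempty : Nonempty Node
  edge : Fin r → Node → Node → Prop
  label : Node → Sym

/-- A digraph with a distinguished node. -/
structure PointedDigraph (Sym : Type) (r : ℕ) where
  graph : LabeledDigraph Sym r
  point : graph.Node

/-! ### Distributed automata -/

/-- A distributed automaton over `Sym`-labeled, `r`-relational digraphs with state set `Q`
(a finite type in all uses below; nonempty because of `init`). -/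
structure DistributedAutomaton (Sym : Type) (r : ℕ) (Q : Type) where
  init : Q
  trans : Sym → Q → (Fin r → Set Q) → Q
  accept : Set Q

namespace DistributedAutomaton

variable {Sym : Type} {r : ℕ} {Q : Type}

/-- The run on a digraph: the configuration at each time. -/
def run (A : DistributedAutomaton Sym r Q) (G : LabeledDigraph Sym r) : ℕ → G.Node → Q
  | 0, _ => A.init
  | t + 1, v =>
      A.trans (G.label v) (run A G t v) fun k => {q | ∃ u, G.edge k u v ∧ run A G t u = q}

/-- `A` accepts a pointed digraph if the distinguished node visits an accepting state. -/
def Accepts (A : DistributedAutomaton Sym r Q) (P : PointedDigraph Sym r) : Prop :=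
  ∃ t, A.run P.graph t P.point ∈ A.accept

/-- The set of all pointed digraphs that `A` accepts. -/
def language (A : DistributedAutomaton Sym r Q) : Set (PointedDigraph Sym r) :=
  {P | A.Accepts P}

/-- The transition functions do not depend on the node's own current state. -/
def IsForgetful (A : DistributedAutomaton Sym r Q) : Prop :=
  ∀ (a : Sym) (q q' : Q) (N : Fin r → Set Q), A.trans a q N = A.trans a q' N

end DistributedAutomaton

/-! ### Binary encoding of forgetful automata -/

/-- The number `m` in unary, followed by a delimiter. -/
def encodeUnary (m : ℕ) : List Bool := List.replicate m true ++ [false]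

/-- A state of an `n`-state automaton as a binary word of the fixed length `Nat.size n`, the number
of binary digits of `n` (least significant bit first). -/
def encodeState {n : ℕ} (q : Fin n) : List Bool :=
  (List.range (Nat.size n)).map fun j => (q : ℕ).testBit j

/-- The `i`-th element of `(𝒫 Q)^r` for `Q = Fin n`, where `i < 2 ^ (n * r)`: the word of the
first `n * r` bits of `i` consists of the characteristic words of the `r` components. -/
def neighborSets (n r i : ℕ) : Fin r → Set (Fin n) :=
  fun k => {q | i.testBit ((k : ℕ) * n + q) = true}

open Classical in
/-- The bit array that represents a set of states. -/
noncomputable def encodeSet {n : ℕ} (S : Set (Fin n)) : List Bool :=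
  (List.finRange n).map fun q => decide (q ∈ S)

/-- The lookup table of the transition function for the symbol `a`, as a function of the
vector of neighbor sets only. The value `A.init` in the place of the node's own state is immaterial
when `A` is forgetful. -/
def encodeTable {s r n : ℕ} (A : DistributedAutomaton (Fin s) r (Fin n)) (a : Fin s) : List Bool :=
  (List.range (2 ^ (n * r))).flatMap fun i => encodeState (A.trans a A.init (neighborSets n r i))

/-- The uncompressed binary encoding of a forgetful automaton with alphabet `{0, …, s - 1}` and
states `{0, …, n - 1}`: the three size parameters, the initial state, the bit array of the set of
accepting states, and one lookup table for each symbol. -/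
noncomputable def encode {s r n : ℕ} (A : DistributedAutomaton (Fin s) r (Fin n)) : List Bool :=
  encodeUnary s ++ encodeUnary r ++ encodeUnary n ++ encodeState A.init ++ encodeSet A.accept ++
    (List.finRange s).flatMap fun a => encodeTable A a

/-- The emptiness problem for forgetful distributed automata as a formal language: all encodings of
forgetful automata whose language is nonempty. -/
def ForgetfulEmptinessProblem : Set (List Bool) :=
  {x | ∃ (s r n : ℕ) (A : DistributedAutomaton (Fin s) r (Fin n)),
    0 < r ∧ A.IsForgetful ∧ A.language.Nonempty ∧ encode A = x}

/-! ### Deterministic logarithmic space -/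

/-- What the input head can see: a bit of the input or one of the two end markers. -/
inductive InputSymbol
  | leftEnd
  | bit (b : Bool)
  | rightEnd

/-- The content of the input tape for `x`: cell `0` and cell `|x| + 1` hold the end markers. -/
def inputSymbol (x : List Bool) : ℕ → InputSymbol
  | 0 => .leftEnd
  | p + 1 => match x[p]? with
    | some b => .bit b
    | none => .rightEnd

inductive Move
  | left
  | stay
  | right

/-- The effect of a move on the position of a head; a left move in cell `0` has no effect. -/
def Move.apply : Move → ℕ → ℕ
  | left, p => p - 1
  | stay, p => p
  | right, p => p + 1

/-- A deterministic Turing machine with a two-way read-only input tape and `tapes` many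
read-write work tapes, each one-way infinite. `verdict q = none` says that `q` is not a halting
state; `some true` and `some false` mark the accepting and the rejecting halting states. -/
structure OfflineTM where
  State : Type
  finiteState : Finite State
  Work : Type
  finiteWork : Finite Work
  blank : Work
  tapes : ℕ
  start : State
  verdict : State → Option Bool
  trans : State → InputSymbol → (Fin tapes → Work) →
    State × Move × (Fin tapes → Work) × (Fin tapes → Move)

namespace OfflineTM

/-- A configuration (without the input, which never changes). -/
structure Cfg (M : OfflineTM) where
  state : M.State
  inputPos : ℕ
  workPos : Fin M.tapes → ℕ
  work : Fin M.tapes → ℕ → M.Work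

/-- The initial configuration: all heads in cell `0`, all work tapes blank. -/
def initCfg (M : OfflineTM) : M.Cfg where
  state := M.start
  inputPos := 0
  workPos := fun _ => 0
  work := fun _ _ => M.blank

/-- One step on the input `x`. The input head never leaves the cells `0, …, |x| + 1`, and halting
configurations are fixed. -/
def step (M : OfflineTM) (x : List Bool) (c : M.Cfg) : M.Cfg :=
  match M.verdict c.state with
  | some _ => c
  | none =>
    let out := M.trans c.state (inputSymbol x c.inputPos) fun i => c.work i (c.workPos i)
    { state := out.1
      inputPos := min (out.2.1.apply c.inputPos) (x.length + 1)
      workPos := fun i => (out.2.2.2 i).apply (c.workPos i)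
      work := fun i => Function.update (c.work i) (c.workPos i) (out.2.2.1 i) }

/-- The configuration after `t` steps on the input `x`. -/
def cfgAt (M : OfflineTM) (x : List Bool) (t : ℕ) : M.Cfg := (M.step x)^[t] M.initCfg

/-- The computation on `x` halts with the verdict `b`. -/
def HaltsWith (M : OfflineTM) (x : List Bool) (b : Bool) : Prop :=
  ∃ t, M.verdict (M.cfgAt x t).state = some b

/-- `M` halts on every input, accepting the members of `L` and rejecting the other words. -/
def Decides (M : OfflineTM) (L : Set (List Bool)) : Prop :=
  ∀ x, (x ∈ L → M.HaltsWith x true) ∧ (x ∉ L → M.HaltsWith x false)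

/-- On the input `x`, the head of each work tape only visits the first `m` cells. -/
def UsesSpace (M : OfflineTM) (x : List Bool) (m : ℕ) : Prop :=
  ∀ t i, (M.cfgAt x t).workPos i < m

end OfflineTM

/-- The class `LogSpace`: languages of binary words that are decided by a deterministic Turing
machine which visits `O(log |x|)` work tape cells on every input `x`. -/
def InLogSpace (L : Set (List Bool)) : Prop :=
  ∃ (M : OfflineTM) (c : ℕ), M.Decides L ∧ ∀ x, M.UsesSpace x (c * Nat.log 2 x.length + c)

end DistAut

/-! In a forgetful automaton the state of a node at time t+1 depends only on its label and on the
states of its neighbors at time t. Let S_0 = {q_0}, and let S_{t+1} consist of all values δ_a(N)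
with every N_k ⊆ S_t. Only states in S_t occur at time t. Conversely, every state in S_t occurs
(`exists_run_eq`): given δ_a(N), take the disjoint union of digraphs that realize the states of S_t
at time t and add a node with label a and edges from the right points. No edge enters the old
digraphs from outside, so their runs are unchanged, and forgetfulness makes the new node's own state
at time t irrelevant. The sets S_t form the orbit of a map on 2^Q, so the language is nonempty iff
some S_t with t < 2^n contains an accepting state (`language_nonempty_iff`).

The space bound rests on the uncompressed encoding. Since r ≥ 1, a lookup table has 2^(nr) ≥ 2^n
entries, so a subset of Q, written as an n-bit number, and the time t are both bounded by the length
of the input and take logarithmically many bits. It suffices to iterate S_t ↦ S_{t+1}, storing only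
the current set (`maskAt`), and to check with bounded quantifiers that the input is an encoding
(`mem_forgetfulEmptinessProblem_iff`).

To obtain a Turing machine, polynomially bounded functions are organized in an algebra `LS` closed
under composition and bounded recursion (`LS.bind`, `LS.natRec`), hence under bounded quantification
and search. Its members are computed by while programs over registers with polynomially bounded
contents. The machine `flowTM` keeps each register in binary on a work tape of its own
(`inLogSpace_of_exec`). -/

namespace DistAut

/-! ### Tape symbols and binary counters -/

/-- Tape alphabet: the start marker, binary digits, and the blank. -/
inductive Cell
  | blank
  | mark
  | bit (b : Bool)
  deriving Fintype

/-- The `j`-th cell of a tape region that holds the word `l`. -/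
def cellAt (l : List Bool) (j : ℕ) : Cell := (l[j]?).elim .blank .bit

theorem cellAt_nil (j : ℕ) : cellAt [] j = .blank := by simp [cellAt]

theorem cellAt_cons_zero (b : Bool) (l : List Bool) : cellAt (b :: l) 0 = .bit b := by
  simp [cellAt]

theorem cellAt_cons_succ (b : Bool) (l : List Bool) (j : ℕ) :
    cellAt (b :: l) (j + 1) = cellAt l j := by
  simp [cellAt]

theorem cellAt_ne_mark (l : List Bool) (j : ℕ) : cellAt l j ≠ .mark := by
  unfold cellAt
  cases l[j]? <;> simp

/-- The number with the binary digits `l`, least significant first. -/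
def binValue : List Bool → ℕ
  | [] => 0
  | b :: l => b.toNat + 2 * binValue l

def binSucc : List Bool → List Bool
  | [] => [true]
  | false :: l => true :: l
  | true :: l => false :: binSucc l

/-- The length is kept, so leading zeros arise and a number has many representations. On words of
value 0 the result is meaningless. -/
def binPred : List Bool → List Bool
  | [] => []
  | true :: l => false :: l
  | false :: l => true :: binPred l

theorem binValue_binSucc (l : List Bool) : binValue (binSucc l) = binValue l + 1 := by
  induction l with
  | nil => rfl
  | cons b l ih => cases b <;> simp [binSucc, binValue, ih] <;> ring

theorem binValue_binPred (l : List Bool) (h : binValue l ≠ 0) :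
    binValue (binPred l) + 1 = binValue l := by
  induction l with
  | nil => simp [binValue] at h
  | cons b l ih =>
    cases b
    · simp only [binValue, Bool.toNat_false, zero_add] at h
      have := ih (by omega)
      simp [binPred, binValue]
      omega
    · simp [binPred, binValue]
      omega

theorem length_binPred (l : List Bool) : (binPred l).length = l.length := by
  induction l with
  | nil => rfl
  | cons b l ih => cases b <;> simp [binPred, ih]

/-- A new digit is needed only if the carry passes through the whole word, that is, if all digits
are 1. Hence leading zeros never push a word beyond the size of the bound for its value. -/
theorem length_binSucc (l : List Bool) :
    (binSucc l).length = l.length ∨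
      (binSucc l).length = l.length + 1 ∧ binValue l + 1 = 2 ^ l.length := by
  induction l with
  | nil => right; simp [binSucc, binValue]
  | cons b l ih =>
    cases b
    · left; simp [binSucc]
    · rcases ih with h | ⟨h, h'⟩
      · left; simp [binSucc, h]
      · right
        simp only [binSucc, List.length_cons, h, binValue, Bool.toNat_true, pow_succ, true_and]
        omega

theorem length_binSucc_le (l : List Bool) (B : ℕ) (hl : l.length ≤ B.size)
    (hB : binValue l + 1 ≤ B) : (binSucc l).length ≤ B.size := by
  rcases length_binSucc l with h | ⟨h, h'⟩
  · omega
  · rw [h]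
    exact Nat.lt_size.2 (by omega)

/-- The tape `T` holds the number `v` in binary behind the start marker. -/
def Holds (B : ℕ) (T : ℕ → Cell) (v : ℕ) : Prop :=
  T 0 = .mark ∧ ∃ l : List Bool, binValue l = v ∧ l.length ≤ B.size ∧ ∀ j, T (1 + j) = cellAt l j

/-! ### Flow charts and their Turing machines -/

/-- Instructions of a counter machine with an input head; `L` is the type of labels. -/
inductive Instr (L : Type)
  | inc (c : InputSymbol → Bool) (i : ℕ) (l : L)
  | dec (i : ℕ) (l : L)
  | jz (i : ℕ) (lz ln : L)
  | home (l : L)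
  | right (l : L)
  | halt (b : Bool)

def Instr.map {L L' : Type} (f : L → L') : Instr L → Instr L'
  | inc c i l => inc c i (f l)
  | dec i l => dec i (f l)
  | jz i lz ln => jz i (f lz) (f ln)
  | home l => home (f l)
  | right l => right (f l)
  | halt b => halt b

theorem Instr.map_map {L L' L'' : Type} (f : L → L') (g : L' → L'') (I : Instr L) :
    (I.map f).map g = I.map (g ∘ f) := by
  cases I <;> rfl

/-- Control states: the initial state, the states at the labels, and the states in which the head
of a work tape returns to the first digit. -/
inductive Ctl (k : ℕ) (L : Type)
  | start
  | ready (l : L)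
  | ret (i : Fin (k + 1)) (l : L)

/-- The next state, the symbol to be written, and the head movement, on one work tape. -/
structure Act (k : ℕ) (L : Type) where
  ctl : Ctl k L
  write : Cell
  move : Move

section Machine

variable {k : ℕ} {L : Type}

def incAct (j : Fin (k + 1)) (l l' : L) : Cell → Act k L
  | .bit true => ⟨.ready l, .bit false, .right⟩
  | _ => ⟨.ret j l', .bit true, .left⟩

def decAct (j : Fin (k + 1)) (l l' : L) : Cell → Act k L
  | .bit true => ⟨.ret j l', .bit false, .left⟩
  | .bit false => ⟨.ready l, .bit true, .right⟩
  | a => ⟨.ready l, a, .stay⟩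

/-- Because of leading zeros, zero is recognized only when the blank is reached without meeting a
digit 1. -/
def jzAct (j : Fin (k + 1)) (l lz ln : L) : Cell → Act k L
  | .bit true => ⟨.ret j ln, .bit true, .left⟩
  | .bit false => ⟨.ready l, .bit false, .right⟩
  | a => ⟨.ret j lz, a, .left⟩

def retAct (j : Fin (k + 1)) (l : L) : Cell → Act k L
  | .mark => ⟨.ready l, .mark, .right⟩
  | a => ⟨.ret j l, a, .left⟩

abbrev Out (k : ℕ) (L : Type) :=
  Ctl k L × Move × (Fin (k + 1) → Cell) × (Fin (k + 1) → Move)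

/-- Only the work tape `j` is active. -/
def workOut (j : Fin (k + 1)) (w : Fin (k + 1) → Cell) (f : Cell → Act k L) : Out k L :=
  ((f (w j)).ctl, .stay, Function.update w j (f (w j)).write,
    Function.update (fun _ => .stay) j (f (w j)).move)

/-- Only the input head is active. -/
def inputOut (w : Fin (k + 1) → Cell) (q : Ctl k L) (m : Move) : Out k L :=
  (q, m, w, fun _ => .stay)

/-- The transition in the state at the label `l`, which carries the instruction given. -/
def readyOut (l : L) (a : InputSymbol) (w : Fin (k + 1) → Cell) : Instr L → Out k L
  | .inc c i l' =>
      if c a then workOut (Fin.ofNat (k + 1) i) w (incAct (Fin.ofNat (k + 1) i) l l')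
      else inputOut w (.ready l') .stay
  | .dec i l' => workOut (Fin.ofNat (k + 1) i) w (decAct (Fin.ofNat (k + 1) i) l l')
  | .jz i lz ln => workOut (Fin.ofNat (k + 1) i) w (jzAct (Fin.ofNat (k + 1) i) l lz ln)
  | .home l' => match a with
    | .leftEnd => inputOut w (.ready l') .stay
    | _ => inputOut w (.ready l) .left
  | .right l' => inputOut w (.ready l') .right
  | .halt _ => inputOut w (.ready l) .stay

def ctlVerdict (code : L → Instr L) : Ctl k L → Option Bool
  | .ready l => match code l with
    | .halt b => some b
    | _ => none
  | _ => none

/-- The Turing machine that executes a flow chart, with a work tape for each register. -/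
abbrev flowTM (k : ℕ) (L : Type) [Finite L] (code : L → Instr L) (entry : L) : OfflineTM where
  State := Ctl k L
  finiteState := by
    refine Finite.of_injective (β := Unit ⊕ L ⊕ (Fin (k + 1) × L)) (fun
      | .start => .inl ()
      | .ready l => .inr (.inl l)
      | .ret i l => .inr (.inr (i, l))) ?_
    intro a b h
    cases a <;> cases b <;> simp_all
  Work := Cell
  finiteWork := inferInstance
  blank := .blank
  tapes := k + 1
  start := .start
  verdict := ctlVerdict code
  trans := fun q a w => match q with
    | .start => (.ready entry, .stay, fun _ => .mark, fun _ => .right)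
    | .ready l => readyOut l a w (code l)
    | .ret i l => workOut i w (retAct i l)

end Machine

/-! ### Space-bounded reachability of configurations -/

namespace OfflineTM

/-- `c'` is reached from `c`, and the work heads stay in the first `m` cells on the way. -/
def Reach (M : OfflineTM) (x : List Bool) (m : ℕ) (c c' : M.Cfg) : Prop :=
  ∃ t, (M.step x)^[t] c = c' ∧ ∀ t' ≤ t, ∀ i, ((M.step x)^[t'] c).workPos i < m

variable {M : OfflineTM} {x : List Bool} {m : ℕ}

theorem Reach.trans {c₁ c₂ c₃ : M.Cfg} (h₁ : M.Reach x m c₁ c₂) (h₂ : M.Reach x m c₂ c₃) :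
    M.Reach x m c₁ c₃ := by
  obtain ⟨t₁, e₁, s₁⟩ := h₁
  obtain ⟨t₂, e₂, s₂⟩ := h₂
  refine ⟨t₂ + t₁, by rw [Function.iterate_add_apply, e₁, e₂], fun t' ht i => ?_⟩
  by_cases h : t' ≤ t₁
  · exact s₁ t' h i
  · have : t' = (t' - t₁) + t₁ := by omega
    rw [this, Function.iterate_add_apply, e₁]
    exact s₂ _ (by omega) i

theorem Reach.of_step {c c' : M.Cfg} (h : M.step x c = c') (hc : ∀ i, c.workPos i < m)
    (hc' : ∀ i, c'.workPos i < m) : M.Reach x m c c' := by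
  refine ⟨1, h, fun t' ht i => ?_⟩
  interval_cases t'
  · exact hc i
  · simpa [h] using hc' i

theorem step_eq {c : M.Cfg} {out : M.State × Move × (Fin M.tapes → M.Work) × (Fin M.tapes → Move)}
    (hv : M.verdict c.state = none)
    (ho : M.trans c.state (inputSymbol x c.inputPos) (fun i => c.work i (c.workPos i)) = out) :
    M.step x c =
      { state := out.1
        inputPos := min (out.2.1.apply c.inputPos) (x.length + 1)
        workPos := fun i => (out.2.2.2 i).apply (c.workPos i)
        work := fun i => Function.update (c.work i) (c.workPos i) (out.2.2.1 i) } := by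
  subst ho
  simp [step, hv]

/-- Halting configurations are fixed points of `step`, so a space bound up to the halting time holds
forever. -/
theorem usesSpace_of_reach {c : M.Cfg} {b : Bool} (h : M.Reach x m M.initCfg c)
    (hb : M.verdict c.state = some b) : M.HaltsWith x b ∧ M.UsesSpace x m := by
  obtain ⟨t, e, s⟩ := h
  refine ⟨⟨t, by rw [cfgAt, e, hb]⟩, fun t' i => ?_⟩
  unfold cfgAt
  by_cases ht : t' ≤ t
  · exact s t' ht i
  · have hfix : M.step x c = c := by simp [step, hb]
    have : t' = (t' - t) + t := by omega
    rw [this, Function.iterate_add_apply, e, Function.iterate_fixed hfix, ← e]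
    exact s t le_rfl i

end OfflineTM

/-! ### Simulation of single flow chart instructions -/

section Simulation

variable {k : ℕ} {L : Type} [Finite L] {code : L → Instr L} {entry : L} {x : List Bool} {m : ℕ}

/-- A configuration of `flowTM` in which only the tape `j` may be in an intermediate state; the
heads of the other tapes rest at the first digit. -/
def flowCfg (code : L → Instr L) (entry : L) (q : Ctl k L) (h : ℕ)
    (W : Fin (k + 1) → ℕ → Cell) (j : Fin (k + 1)) (p : ℕ) (T : ℕ → Cell) :
    (flowTM k L code entry).Cfg where
  state := q
  inputPos := h
  workPos := (Function.update (fun _ => 1) j p : Fin (k + 1) → ℕ)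
  work := (Function.update W j T : Fin (k + 1) → ℕ → Cell)

theorem step_flowCfg {q : Ctl k L} {h : ℕ} {W : Fin (k + 1) → ℕ → Cell} {j : Fin (k + 1)}
    {p : ℕ} {T : ℕ → Cell} {f : Cell → Act k L} (hv : ctlVerdict code q = none)
    (ht : ∀ w : Fin (k + 1) → Cell, w j = T p → (flowTM k L code entry).trans q (inputSymbol x h) w =
      workOut j w f)
    (hh : h ≤ x.length + 1) :
    (flowTM k L code entry).step x (flowCfg code entry q h W j p T) =
      flowCfg code entry (f (T p)).ctl h W j ((f (T p)).move.apply p)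
        (Function.update T p (f (T p)).write) := by
  have ho := ht (fun i => Function.update W j T i (Function.update (fun _ => 1) j p i)) (by simp)
  rw [OfflineTM.step_eq (c := flowCfg code entry q h W j p T) hv ho]
  simp only [workOut, flowCfg, OfflineTM.Cfg.mk.injEq]
  refine ⟨by simp, by simpa [Move.apply] using hh, ?_, ?_⟩
  · funext i
    by_cases hi : i = j
    · subst hi; simp
    · simp [hi, Move.apply]
  · funext i
    by_cases hi : i = j
    · subst hi; simp
    · simp [hi]

theorem flowCfg_pos_lt {q : Ctl k L} {h : ℕ} {W : Fin (k + 1) → ℕ → Cell} {j : Fin (k + 1)}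
    {p : ℕ} {T : ℕ → Cell} (hm : 1 < m) (hp : p < m) (i : Fin (k + 1)) :
    (flowCfg code entry q h W j p T).workPos i < m := by
  by_cases hi : i = j
  · subst hi; simpa [flowCfg] using hp
  · simpa [flowCfg, hi] using hm

theorem reach_step_flowCfg {q : Ctl k L} {h : ℕ} {W : Fin (k + 1) → ℕ → Cell} {j : Fin (k + 1)}
    {p : ℕ} {T : ℕ → Cell} (f : Cell → Act k L) (hv : ctlVerdict code q = none)
    (ht : ∀ w : Fin (k + 1) → Cell, w j = T p → (flowTM k L code entry).trans q (inputSymbol x h) w =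
      workOut j w f)
    (hh : h ≤ x.length + 1) (hm : 1 < m) (hp : p < m) {q' : Ctl k L} {p' : ℕ} {a : Cell}
    (hq' : (f (T p)).ctl = q') (hp' : (f (T p)).move.apply p = p') (ha : (f (T p)).write = a)
    (hpm : p' < m) :
    (flowTM k L code entry).Reach x m (flowCfg code entry q h W j p T)
      (flowCfg code entry q' h W j p' (Function.update T p a)) := by
  subst hq' hp' ha
  exact .of_step (step_flowCfg hv ht hh) (flowCfg_pos_lt hm hp) (flowCfg_pos_lt hm hpm)

/-- The head of a work tape returns to the first digit. -/
theorem reach_ret {l : L} {h : ℕ} {W : Fin (k + 1) → ℕ → Cell} {j : Fin (k + 1)}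
    {T : ℕ → Cell} (hh : h ≤ x.length + 1) (hm : 1 < m) (h0 : T 0 = .mark)
    (p : ℕ) (hp : p < m) (hT : ∀ i, 0 < i → i ≤ p → T i ≠ .mark) :
    (flowTM k L code entry).Reach x m (flowCfg code entry (.ret j l) h W j p T)
      (flowCfg code entry (.ready l) h W j 1 T) := by
  induction p with
  | zero =>
    have := reach_step_flowCfg (code := code) (entry := entry) (x := x) (W := W) (j := j) (T := T)
      (q := .ret j l) (p := 0) (retAct j l) rfl (fun w hw => rfl) hh hm hp
      (q' := .ready l) (p' := 1) (a := .mark)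
      (by simp [h0, retAct]) (by simp [h0, retAct, Move.apply]) (by simp [h0, retAct]) hm
    rwa [← h0, Function.update_eq_self] at this
  | succ p ih =>
    have hne := hT (p + 1) (by omega) le_rfl
    have hr : retAct j l (T (p + 1)) = ⟨.ret j l, T (p + 1), .left⟩ := by
      unfold retAct
      split
      · contradiction
      · rfl
    have := reach_step_flowCfg (code := code) (entry := entry) (x := x) (W := W) (j := j) (T := T)
      (q := .ret j l) (p := p + 1) (retAct j l) rfl (fun w hw => rfl) hh hm hp
      (q' := .ret j l) (p' := p) (a := T (p + 1))
      (by simp [hr]) (by simp [hr, Move.apply]) (by simp [hr]) (by omega)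
    rw [Function.update_eq_self] at this
    exact this.trans (ih (by omega) fun i h1 h2 => hT i h1 (by omega))

/-- A word operation `g` that is carried out digit by digit in the state `ready l` by the actions
`f`, until the state `ret j l'` is entered. -/
theorem reach_scan {l l' : L} {h : ℕ} {W : Fin (k + 1) → ℕ → Cell} {j : Fin (k + 1)}
    {f : Cell → Act k L} {g : List Bool → List Bool} {ok : List Bool → Prop}
    (hv : ctlVerdict code (.ready l : Ctl k L) = none)
    (ht : ∀ w : Fin (k + 1) → Cell, (flowTM k L code entry).trans (.ready l) (inputSymbol x h) w =
      workOut j w f)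
    (hh : h ≤ x.length + 1)
    (hnil : ok [] → f .blank = ⟨.ret j l', cellAt (g []) 0, .left⟩ ∧ (g []).length ≤ 1)
    (hcons : ∀ b u, ok (b :: u) → ∃ b',
      (f (.bit b) = ⟨.ret j l', .bit b', .left⟩ ∧ g (b :: u) = b' :: u) ∨
      (f (.bit b) = ⟨.ready l, .bit b', .right⟩ ∧ g (b :: u) = b' :: g u ∧ ok u))
    (u : List Bool) (hu : ok u) (p : ℕ) (T : ℕ → Cell) (hp : 0 < p) (hm : p + u.length < m)
    (hT : ∀ i, T (p + i) = cellAt u i) :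
    ∃ p' T', p' < m ∧ (∀ i < p, T' i = T i) ∧ (∀ i, T' (p + i) = cellAt (g u) i) ∧
      (flowTM k L code entry).Reach x m (flowCfg code entry (.ready l) h W j p T)
        (flowCfg code entry (.ret j l') h W j p' T') := by
  induction u generalizing p T with
  | nil =>
    obtain ⟨hf, hg⟩ := hnil hu
    have hTp : T p = .blank := by simpa [cellAt_nil] using hT 0
    simp only [List.length_nil, add_zero] at hm
    refine ⟨p - 1, Function.update T p (cellAt (g []) 0), by omega, fun i hi => ?_, fun i => ?_,
      reach_step_flowCfg f hv (fun w _ => ht w) hh (by omega) hm ?_ ?_ ?_ (by omega)⟩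
    · rw [Function.update_of_ne (by omega)]
    · cases i with
      | zero => simp
      | succ i =>
        rw [Function.update_of_ne (by omega), hT, cellAt_nil]
        simp only [cellAt]
        rw [List.getElem?_eq_none (by omega)]
        rfl
    all_goals rw [hTp, hf]
    rfl
  | cons b u ih =>
    have hTp : T p = .bit b := by simpa [cellAt_cons_zero] using hT 0
    simp only [List.length_cons] at hm
    have hT' : ∀ i, T (p + 1 + i) = cellAt u i := fun i => by
      rw [add_assoc, add_comm 1 i, hT, cellAt_cons_succ]
    obtain ⟨b', ⟨hf, hg⟩ | ⟨hf, hg, hok⟩⟩ := hcons b u hu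
    · refine ⟨p - 1, Function.update T p (.bit b'), by omega, fun i hi => ?_, fun i => ?_,
        reach_step_flowCfg f hv (fun w _ => ht w) hh (by omega) (by omega) ?_ ?_ ?_ (by omega)⟩
      · rw [Function.update_of_ne (by omega)]
      · cases i with
        | zero => simp [hg, cellAt_cons_zero]
        | succ i => rw [Function.update_of_ne (by omega), hT, hg, cellAt_cons_succ,
                      cellAt_cons_succ]
      all_goals rw [hTp, hf]
      rfl
    · have hs := reach_step_flowCfg (code := code) (entry := entry) (x := x) (W := W) (j := j)
        (T := T) (m := m) (p := p) (q' := .ready l) (p' := p + 1) (a := .bit b')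
        f hv (fun w _ => ht w) hh (by omega) (by omega)
        (by rw [hTp, hf]) (by rw [hTp, hf]; rfl) (by rw [hTp, hf]) (by omega)
      obtain ⟨p', T', h1, h2, h3, h4⟩ := ih hok (p + 1) (Function.update T p (.bit b')) (by omega)
        (by omega) (fun i => by rw [Function.update_of_ne (by omega), hT'])
      refine ⟨p', T', h1, fun i hi => ?_, fun i => ?_, hs.trans h4⟩
      · rw [h2 i (by omega), Function.update_of_ne (by omega)]
      · cases i with
        | zero => rw [add_zero, h2 p (by omega), Function.update_self, hg, cellAt_cons_zero]
        | succ i => rw [hg, cellAt_cons_succ, ← h3 i]; congr 1; ring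

/-- The configuration at the label `l` represents the register contents `σ` and the input
position `h`. -/
def Rep (code : L → Instr L) (entry : L) (x : List Bool) (B : ℕ) (c : (flowTM k L code entry).Cfg)
    (l : L) (σ : ℕ → ℕ) (h : ℕ) : Prop :=
  h ≤ x.length + 1 ∧ ∃ W, c = flowCfg code entry (.ready l) h W 0 1 (W 0) ∧
    ∀ i : Fin (k + 1), Holds B (W i) (σ i)

/-- Between instructions all heads rest at cell 1, so it is immaterial which tape is singled out;
`Rep` uses tape 0 as a normal form. -/
theorem flowCfg_rest {q : Ctl k L} {h : ℕ} {W : Fin (k + 1) → ℕ → Cell} (j : Fin (k + 1)) :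
    flowCfg code entry q h W j 1 (W j) = flowCfg code entry q h W 0 1 (W 0) := by
  simp [flowCfg]

theorem flowCfg_rest_update {q : Ctl k L} {h : ℕ} {W : Fin (k + 1) → ℕ → Cell} (j : Fin (k + 1))
    (T : ℕ → Cell) :
    flowCfg code entry q h W j 1 T =
      flowCfg code entry q h (Function.update W j T) 0 1 (Function.update W j T 0) := by
  simp [flowCfg]

/-- A word operation that is carried out on the tape of the register `i`. -/
theorem reach_operation {l l' : L} {h : ℕ} {σ : ℕ → ℕ} {i : ℕ} {B : ℕ}
    {f : Cell → Act k L} {g : List Bool → List Bool} {ok : List Bool → Prop}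
    (hi : i ≤ k) (hv : ctlVerdict code (.ready l : Ctl k L) = none)
    (ht : ∀ w : Fin (k + 1) → Cell, (flowTM k L code entry).trans (.ready l) (inputSymbol x h) w =
      workOut (Fin.ofNat (k + 1) i) w f)
    (hnil : ok [] → f .blank = ⟨.ret (Fin.ofNat (k + 1) i) l', cellAt (g []) 0, .left⟩ ∧
      (g []).length ≤ 1)
    (hcons : ∀ b u, ok (b :: u) → ∃ b',
      (f (.bit b) = ⟨.ret (Fin.ofNat (k + 1) i) l', .bit b', .left⟩ ∧ g (b :: u) = b' :: u) ∨
      (f (.bit b) = ⟨.ready l, .bit b', .right⟩ ∧ g (b :: u) = b' :: g u ∧ ok u))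
    (hok : ∀ u, binValue u = σ i → ok u)
    (hlen : ∀ u, binValue u = σ i → u.length ≤ B.size → (g u).length ≤ B.size)
    {v : ℕ} (hval : ∀ u, binValue u = σ i → binValue (g u) = v)
    {c : (flowTM k L code entry).Cfg} (hc : Rep code entry x B c l σ h) :
    ∃ c', Rep code entry x B c' l' (Function.update σ i v) h ∧
      (flowTM k L code entry).Reach x (B.size + 2) c c' := by
  obtain ⟨hh, W, rfl, hW⟩ := hc
  set j := Fin.ofNat (k + 1) i with hj
  have hji : (j : ℕ) = i := by simp [hj, Nat.mod_eq_of_lt (Nat.lt_succ_of_le hi)]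
  obtain ⟨h0, u, hu, hul, hT⟩ := hW j
  rw [hji] at hu
  obtain ⟨p', T', h1, h2, h3, h4⟩ := reach_scan (m := B.size + 2) (W := W) hv ht hh hnil hcons u
    (hok u hu) 1 (W j) one_pos (by omega) hT
  have h0' : T' 0 = .mark := by rw [h2 0 one_pos, h0]
  have h5 := reach_ret (code := code) (entry := entry) (l := l') (W := W) (j := j) hh
    (show 1 < B.size + 2 by omega) h0' p' h1 (fun i hi _ => by
      have := h3 (i - 1)
      rw [show 1 + (i - 1) = i by omega] at this
      rw [this]
      exact cellAt_ne_mark _ _)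
  refine ⟨_, ⟨hh, Function.update W j T', rfl, fun i' => ?_⟩, ?_⟩
  · by_cases hi' : i' = j
    · subst hi'
      rw [Function.update_self, hji, Function.update_self]
      exact ⟨h0', g u, hval u hu, hlen u hu hul, h3⟩
    · rw [Function.update_of_ne hi', Function.update_of_ne]
      · exact hW i'
      · rw [← hji]
        exact fun h => hi' (Fin.ext h)
  · rw [← flowCfg_rest_update, ← flowCfg_rest j]
    exact h4.trans h5

theorem reach_inc {c : InputSymbol → Bool} {i : ℕ} {l l' : L} {h B : ℕ} {σ : ℕ → ℕ}
    (hl : code l = .inc c i l') (hi : i ≤ k) (hB : c (inputSymbol x h) = true → σ i + 1 ≤ B)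
    {C : (flowTM k L code entry).Cfg} (hC : Rep code entry x B C l σ h) :
    ∃ C', Rep code entry x B C' l'
        (if c (inputSymbol x h) then Function.update σ i (σ i + 1) else σ) h ∧
      (flowTM k L code entry).Reach x (B.size + 2) C C' := by
  have hv : ctlVerdict code (.ready l : Ctl k L) = none := by simp [ctlVerdict, hl]
  by_cases hc : c (inputSymbol x h) = true
  · rw [if_pos hc]
    refine reach_operation (f := incAct (Fin.ofNat (k + 1) i) l l') (g := binSucc)
      (ok := fun _ => True) hi hv (fun w => ?_) (fun _ => ?_) (fun b u _ => ?_) (fun _ _ => trivial)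
      (fun u hu hul => length_binSucc_le u B hul (by rw [hu]; exact hB hc))
      (fun u hu => by rw [binValue_binSucc, hu]) hC
    · simp [flowTM, readyOut, hl, hc]
    · simp [incAct, binSucc, cellAt]
    · cases b
      · exact ⟨true, .inl ⟨rfl, rfl⟩⟩
      · exact ⟨false, .inr ⟨rfl, rfl, trivial⟩⟩
  · rw [if_neg hc]
    obtain ⟨hh, W, rfl, hW⟩ := hC
    refine ⟨_, ⟨hh, W, rfl, hW⟩, .of_step ?_ (flowCfg_pos_lt (by omega) (by omega))
      (flowCfg_pos_lt (by omega) (by omega))⟩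
    simp [OfflineTM.step, flowCfg, flowTM, hv, readyOut, hl, hc, inputOut, Move.apply, hh]

theorem reach_dec {i : ℕ} {l l' : L} {h B : ℕ} {σ : ℕ → ℕ}
    (hl : code l = .dec i l') (hi : i ≤ k) (hpos : σ i ≠ 0)
    {C : (flowTM k L code entry).Cfg} (hC : Rep code entry x B C l σ h) :
    ∃ C', Rep code entry x B C' l' (Function.update σ i (σ i - 1)) h ∧
      (flowTM k L code entry).Reach x (B.size + 2) C C' := by
  have hv : ctlVerdict code (.ready l : Ctl k L) = none := by simp [ctlVerdict, hl]
  -- The invariant `ok` says that the unread suffix still contains a 1, so the borrow never runs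
  -- into the blank.
  refine reach_operation (f := decAct (Fin.ofNat (k + 1) i) l l') (g := binPred)
    (ok := fun u => binValue u ≠ 0) hi hv (fun w => ?_) (fun h => absurd rfl h) (fun b u hu => ?_)
    (fun u hu => by rwa [hu]) (fun u hu hul => by rwa [length_binPred])
    (fun u hu => ?_) hC
  · simp [flowTM, readyOut, hl]
  · cases b
    · refine ⟨true, .inr ⟨rfl, rfl, ?_⟩⟩
      simpa [binValue] using hu
    · exact ⟨false, .inl ⟨rfl, rfl⟩⟩
  · have := binValue_binPred u (by rwa [hu])
    omega

theorem reach_jz {i : ℕ} {l lz ln : L} {h B : ℕ} {σ : ℕ → ℕ}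
    (hl : code l = .jz i lz ln) (hi : i ≤ k)
    {C : (flowTM k L code entry).Cfg} (hC : Rep code entry x B C l σ h) :
    ∃ C', Rep code entry x B C' (if σ i = 0 then lz else ln) σ h ∧
      (flowTM k L code entry).Reach x (B.size + 2) C C' := by
  have hv : ctlVerdict code (.ready l : Ctl k L) = none := by simp [ctlVerdict, hl]
  -- The test is a scan that leaves the word unchanged. By `ok`, the unread suffix is zero iff the
  -- whole register is, so the cell that ends the scan selects the right label.
  have key := reach_operation (l' := if σ i = 0 then lz else ln)
    (f := jzAct (Fin.ofNat (k + 1) i) l lz ln) (g := id) (v := σ i)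
    (ok := fun u => (binValue u = 0 ↔ σ i = 0)) hi hv (fun w => ?_) (fun h => ?_) (fun b u hu => ?_)
    (fun u hu => by rw [hu]) (fun u hu hul => hul) (fun u hu => hu) hC
  · rwa [Function.update_eq_self] at key
  · simp [flowTM, readyOut, hl]
  · rw [if_pos (h.1 rfl)]
    simp [jzAct, cellAt]
  · cases b
    · exact ⟨false, .inr ⟨rfl, rfl, by simpa [binValue] using hu⟩⟩
    · refine ⟨true, .inl ⟨?_, rfl⟩⟩
      rw [if_neg fun h => by simp [binValue, h] at hu]
      rfl

theorem reach_home {l l' : L} {h B : ℕ} {σ : ℕ → ℕ} (hl : code l = .home l')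
    {C : (flowTM k L code entry).Cfg} (hC : Rep code entry x B C l σ h) :
    ∃ C', Rep code entry x B C' l' σ 0 ∧
      (flowTM k L code entry).Reach x (B.size + 2) C C' := by
  have hv : ctlVerdict code (.ready l : Ctl k L) = none := by simp [ctlVerdict, hl]
  obtain ⟨hh, W, rfl, hW⟩ := hC
  induction h with
  | zero =>
    refine ⟨_, ⟨hh, W, rfl, hW⟩, .of_step ?_ (flowCfg_pos_lt (by omega) (by omega))
      (flowCfg_pos_lt (by omega) (by omega))⟩
    simp [OfflineTM.step, flowCfg, flowTM, hv, readyOut, hl, inputOut, Move.apply, inputSymbol]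
  | succ h ih =>
    obtain ⟨C', h1, h2⟩ := ih (by omega)
    refine ⟨C', h1, .trans (.of_step ?_ (flowCfg_pos_lt (by omega) (by omega))
      (flowCfg_pos_lt (by omega) (by omega))) h2⟩
    -- Only cell 0 shows the left end marker, so at position h + 1 the instruction `home` moves
    -- left.
    have hs : readyOut (k := k) l (inputSymbol x (h + 1)) = fun w I => match I with
        | .home _ => inputOut w (.ready l) .left
        | I => readyOut l (inputSymbol x (h + 1)) w I := by
      funext w I
      cases I <;> simp only [readyOut]
      split
      · rename_i he
        simp only [inputSymbol] at he
        split at he <;> simp at he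
      · rfl
    simp [OfflineTM.step, flowCfg, flowTM, hv, hs, hl, inputOut, Move.apply]
    omega

theorem reach_right {l l' : L} {h B : ℕ} {σ : ℕ → ℕ} (hl : code l = .right l')
    {C : (flowTM k L code entry).Cfg} (hC : Rep code entry x B C l σ h) :
    ∃ C', Rep code entry x B C' l' σ (min (h + 1) (x.length + 1)) ∧
      (flowTM k L code entry).Reach x (B.size + 2) C C' := by
  have hv : ctlVerdict code (.ready l : Ctl k L) = none := by simp [ctlVerdict, hl]
  obtain ⟨hh, W, rfl, hW⟩ := hC
  refine ⟨_, ⟨by omega, W, rfl, hW⟩, .of_step ?_ (flowCfg_pos_lt (by omega) (by omega))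
    (flowCfg_pos_lt (by omega) (by omega))⟩
  simp [OfflineTM.step, flowCfg, flowTM, hv, readyOut, hl, inputOut, Move.apply]

theorem reach_start (B : ℕ) :
    ∃ C', Rep code entry x B C' entry (fun _ => 0) 0 ∧
      (flowTM k L code entry).Reach x (B.size + 2) (flowTM k L code entry).initCfg C' := by
  refine ⟨_, ⟨by omega, fun _ => Function.update (fun _ => .blank) 0 .mark, rfl, fun i =>
    ⟨by simp, [], rfl, by simp, fun j => ?_⟩⟩, .of_step ?_ (fun i => ?_)
      (flowCfg_pos_lt (by omega) (by omega))⟩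
  · simp [Function.update, cellAt_nil]
  · simp [OfflineTM.step, flowCfg, flowTM, OfflineTM.initCfg, ctlVerdict, Move.apply]
  · simp [OfflineTM.initCfg]

end Simulation

/-! ### While programs -/

/-- While programs over registers that hold numbers, with an input head. -/
inductive Prog
  | inc (c : InputSymbol → Bool) (i : ℕ)
  | dec (i : ℕ)
  | home
  | right
  | seq (p q : Prog)
  | loop (i : ℕ) (p : Prog)

namespace Prog

/-- An upper bound for the indices of the registers that occur in a program. -/
def maxReg : Prog → ℕ
  | inc _ i => i
  | dec i => i
  | home => 0
  | right => 0
  | seq p q => max p.maxReg q.maxReg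
  | loop i p => max i p.maxReg

/-- The labels of the flow chart of a program, apart from the exit. -/
def Lab : Prog → Type
  | seq p q => p.Lab ⊕ q.Lab
  | loop _ p => Option p.Lab
  | _ => Unit

theorem finite_lab : ∀ p : Prog, Finite p.Lab
  | inc _ _ => inferInstanceAs (Finite Unit)
  | dec _ => inferInstanceAs (Finite Unit)
  | home => inferInstanceAs (Finite Unit)
  | right => inferInstanceAs (Finite Unit)
  | seq p q => by
      have := p.finite_lab
      have := q.finite_lab
      exact inferInstanceAs (Finite (p.Lab ⊕ q.Lab))
  | loop _ p => by
      have := p.finite_lab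
      exact inferInstanceAs (Finite (Option p.Lab))

def entry : (p : Prog) → p.Lab
  | inc _ _ => ()
  | dec _ => ()
  | home => ()
  | right => ()
  | seq p _ => .inl p.entry
  | loop _ _ => (none : Option _)

/-- Redirection of the labels of the first part of a sequence. -/
def seqLeft (p q : Prog) : Option p.Lab → Option (seq p q).Lab
  | none => some (.inr q.entry)
  | some l => some (.inl l)

def seqRight (p q : Prog) : Option q.Lab → Option (seq p q).Lab
  | none => none
  | some l => some (.inr l)

/-- Redirection of the labels of the body of a loop. -/
def loopBody (i : ℕ) (p : Prog) (l : Option p.Lab) : Option (loop i p).Lab := some l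

/-- The flow chart of a program; the exit is `none`. -/
def code : (p : Prog) → p.Lab → Instr (Option p.Lab)
  | inc c i, _ => .inc c i none
  | dec i, _ => .dec i none
  | home, _ => .home none
  | right, _ => .right none
  | seq p q, .inl l => (p.code l).map (seqLeft p q)
  | seq p q, .inr l => (q.code l).map (seqRight p q)
  | loop i p, (none : Option _) => .jz i none (loopBody i p (some p.entry))
  | loop i p, some l => (p.code l).map (loopBody i p)

end Prog

/-- Big-step semantics on the input `x`: register contents and position of the input head before
and after the execution, during which no register is incremented beyond `B`. -/
inductive Exec (x : List Bool) (B : ℕ) : Prog → (ℕ → ℕ) → ℕ → (ℕ → ℕ) → ℕ → Prop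
  | inc {c i σ h} (hB : c (inputSymbol x h) = true → σ i + 1 ≤ B) :
      Exec x B (.inc c i) σ h
        (if c (inputSymbol x h) then Function.update σ i (σ i + 1) else σ) h
  | dec {i σ h} (hi : σ i ≠ 0) : Exec x B (.dec i) σ h (Function.update σ i (σ i - 1)) h
  | home {σ h} : Exec x B .home σ h σ 0
  | right {σ h} : Exec x B .right σ h σ (min (h + 1) (x.length + 1))
  | seq {p q σ h σ' h' σ'' h''} (hp : Exec x B p σ h σ' h') (hq : Exec x B q σ' h' σ'' h'') :
      Exec x B (.seq p q) σ h σ'' h''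
  | loop_zero {i p σ h} (hi : σ i = 0) : Exec x B (.loop i p) σ h σ h
  | loop_succ {i p σ h σ' h' σ'' h''} (hi : σ i ≠ 0) (hp : Exec x B p σ h σ' h')
      (hl : Exec x B (.loop i p) σ' h' σ'' h'') : Exec x B (.loop i p) σ h σ'' h''

theorem Exec.mono {x : List Bool} {B B' : ℕ} (hB : B ≤ B') {p : Prog} {σ h σ' h'}
    (H : Exec x B p σ h σ' h') : Exec x B' p σ h σ' h' := by
  induction H with
  | inc h => exact .inc fun hc => (h hc).trans hB
  | dec h => exact .dec h
  | home => exact .home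
  | right => exact .right
  | seq _ _ ih₁ ih₂ => exact .seq ih₁ ih₂
  | loop_zero h => exact .loop_zero h
  | loop_succ h _ _ ih₁ ih₂ => exact .loop_succ h ih₁ ih₂

/-! ### Simulation of while programs -/

section ProgSimulation

variable {k : ℕ} {L : Type} [Finite L] {code : L → Instr L} {entry : L} {x : List Bool}

/-- The machine of a flow chart that contains the flow chart of `p`, with labels renamed by `ψ`,
executes `p`. -/
theorem Exec.reach {B : ℕ} {p : Prog} {σ h σ' h'} (H : Exec x B p σ h σ' h') (hk : p.maxReg ≤ k)
    (ψ : Option p.Lab → L) (hψ : ∀ l, code (ψ (some l)) = (p.code l).map ψ)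
    {C : (flowTM k L code entry).Cfg} (hC : Rep code entry x B C (ψ (some p.entry)) σ h) :
    ∃ C', Rep code entry x B C' (ψ none) σ' h' ∧
      (flowTM k L code entry).Reach x (B.size + 2) C C' := by
  induction H generalizing C with
  | inc h => exact reach_inc (hψ _) hk h hC
  | dec h => exact reach_dec (hψ _) hk h hC
  | home => exact reach_home (hψ _) hC
  | right => exact reach_right (hψ _) hC
  | @seq p q _ _ _ _ _ _ _ _ ih₁ ih₂ =>
    obtain ⟨C₁, h₁, r₁⟩ := ih₁ ((le_max_left _ _).trans hk) (ψ ∘ Prog.seqLeft p q)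
      (fun l => by rw [← Instr.map_map]; exact hψ (.inl l)) hC
    obtain ⟨C₂, h₂, r₂⟩ := ih₂ ((le_max_right _ _).trans hk) (ψ ∘ Prog.seqRight p q)
      (fun l => by rw [← Instr.map_map]; exact hψ (.inr l)) h₁
    exact ⟨C₂, h₂, r₁.trans r₂⟩
  | loop_zero hi =>
    have := reach_jz (hψ none) ((le_max_left _ _).trans hk) hC
    rwa [if_pos hi] at this
  | @loop_succ i p _ _ _ _ _ _ hi _ _ ih₁ ih₂ =>
    have := reach_jz (hψ none) ((le_max_left _ _).trans hk) hC
    rw [if_neg hi] at this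
    obtain ⟨C₀, h₀, r₀⟩ := this
    -- `loopBody` sends the exit `none` of the body to `some none`, the label of the loop test, so
    -- the second induction hypothesis starts where this one ends.
    obtain ⟨C₁, h₁, r₁⟩ := ih₁ ((le_max_right _ _).trans hk) (ψ ∘ Prog.loopBody i p)
      (fun l => by rw [← Instr.map_map]; exact hψ (some l)) h₀
    obtain ⟨C₂, h₂, r₂⟩ := ih₂ hk ψ hψ h₁
    exact ⟨C₂, h₂, (r₀.trans r₁).trans r₂⟩

end ProgSimulation

/-- A program followed by a test of the register `0`. -/
def deciderCode (p : Prog) : Option p.Lab ⊕ Bool → Instr (Option p.Lab ⊕ Bool)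
  | .inl (some l) => (p.code l).map .inl
  | .inl none => .jz 0 (.inr false) (.inr true)
  | .inr b => .halt b

theorem size_pow_le (a d : ℕ) : (a ^ d).size ≤ d * a.size + 1 := by
  have h : a ^ d < 2 ^ (d * a.size + 1) := by
    calc a ^ d ≤ (2 ^ a.size) ^ d := Nat.pow_le_pow_left (Nat.lt_size_self a).le d
      _ = 2 ^ (d * a.size) := by rw [← pow_mul, mul_comm]
      _ < 2 ^ (d * a.size + 1) := Nat.pow_lt_pow_right (by norm_num) (by omega)
  exact Nat.size_le.2 h

theorem size_add_two_le (n : ℕ) : (n + 2).size ≤ Nat.log 2 n + 2 := by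
  have h := Nat.lt_pow_succ_log_self (b := 2) (by norm_num) n
  refine Nat.size_le.2 ?_
  have : 1 ≤ 2 ^ Nat.log 2 n := Nat.one_le_two_pow
  simp only [Nat.succ_eq_add_one, pow_succ] at h ⊢
  omega

/-- A language is in `LogSpace` if it is decided by a program whose registers hold polynomially
bounded numbers. -/
theorem inLogSpace_of_exec {X : Set (List Bool)} {p : Prog} {d : ℕ}
    (h : ∀ x, ∃ σ h, Exec x ((x.length + 2) ^ d) p (fun _ => 0) 0 σ h ∧ (σ 0 ≠ 0 ↔ x ∈ X)) :
    InLogSpace X := by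
  have := p.finite_lab
  have key : ∀ x, ∀ b, (b = true ↔ x ∈ X) →
      (flowTM p.maxReg _ (deciderCode p) (.inl (some p.entry))).HaltsWith x b ∧
      (flowTM p.maxReg _ (deciderCode p) (.inl (some p.entry))).UsesSpace x
        (((x.length + 2) ^ d).size + 2) := by
    intro x b hb
    obtain ⟨σ, i, hE, hσ⟩ := h x
    obtain ⟨C₀, h₀, r₀⟩ := reach_start (k := p.maxReg) (code := deciderCode p)
      (entry := .inl (some p.entry)) (x := x) ((x.length + 2) ^ d)
    obtain ⟨C₁, h₁, r₁⟩ := hE.reach le_rfl (L := Option p.Lab ⊕ Bool) Sum.inl (fun l => rfl) h₀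
    obtain ⟨C₂, h₂, r₂⟩ := reach_jz (code := deciderCode p)
      (lz := Sum.inr false) (ln := Sum.inr true) rfl (Nat.zero_le _) h₁
    have e : (if σ 0 = 0 then Sum.inr false else Sum.inr true : Option p.Lab ⊕ Bool) = .inr b := by
      cases b <;> simp_all
    rw [e] at h₂
    obtain ⟨_, W, rfl, _⟩ := h₂
    exact OfflineTM.usesSpace_of_reach ((r₀.trans r₁).trans r₂) rfl
  -- The size of (|x| + 2)^d is at most d (log |x| + 2) + 1; two more cells allow for the start
  -- marker and the cell behind the last digit.
  refine ⟨flowTM p.maxReg _ (deciderCode p) (.inl (some p.entry)), 2 * d + 3,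
    fun x => ⟨fun hx => (key x true (by simpa)).1, fun hx => (key x false (by simpa)).1⟩,
    fun x t i => ?_⟩
  classical
  refine ((key x (decide (x ∈ X)) (by simp)).2 t i).trans_le ?_
  have h1 := size_pow_le (x.length + 2) d
  have h2 := Nat.mul_le_mul_left d (size_add_two_le x.length)
  calc _ ≤ d * (Nat.log 2 x.length + 2) + 3 := by omega
    _ ≤ _ := by nlinarith [Nat.zero_le (d * Nat.log 2 x.length), Nat.zero_le (Nat.log 2 x.length)]

/-! ### Programs without regard to the input head -/

/-- The program `p` transforms the register contents `σ` into `σ'`, wherever the input head is. -/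
def Runs (x : List Bool) (B : ℕ) (p : Prog) (σ σ' : ℕ → ℕ) : Prop :=
  ∀ h, ∃ h', Exec x B p σ h σ' h'

section Runs

variable {x : List Bool} {B : ℕ} {p q : Prog} {σ σ' σ'' : ℕ → ℕ}

theorem Runs.mono {B' : ℕ} (H : Runs x B p σ σ') (hB : B ≤ B') : Runs x B' p σ σ' := fun h =>
  let ⟨h', e⟩ := H h
  ⟨h', e.mono hB⟩

theorem Runs.seq (h₁ : Runs x B p σ σ') (h₂ : Runs x B q σ' σ'') : Runs x B (.seq p q) σ σ'' :=
  fun h =>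
    let ⟨h', e₁⟩ := h₁ h
    let ⟨h'', e₂⟩ := h₂ h'
    ⟨h'', .seq e₁ e₂⟩

theorem Runs.dec {i : ℕ} (hi : σ i ≠ 0) :
    Runs x B (.dec i) σ (Function.update σ i (σ i - 1)) :=
  fun h => ⟨h, .dec hi⟩

/-- Unconditional increment. -/
def Prog.succ (i : ℕ) : Prog := .inc (fun _ => true) i

theorem Exec.succ {i h : ℕ} (hi : σ i + 1 ≤ B) :
    Exec x B (.succ i) σ h (Function.update σ i (σ i + 1)) h := by
  have := Exec.inc (x := x) (B := B) (c := fun _ => true) (i := i) (σ := σ) (h := h) (fun _ => hi)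
  rwa [if_pos rfl] at this

theorem Runs.succ {i : ℕ} (hi : σ i + 1 ≤ B) :
    Runs x B (.succ i) σ (Function.update σ i (σ i + 1)) :=
  fun h => ⟨h, .succ hi⟩

/-- In place of an invariant, the whole sequence of register contents and head positions at the
successive loop tests is given explicitly. -/
theorem Exec.loop_seq {i : ℕ} (S : ℕ → ℕ → ℕ) (H : ℕ → ℕ) (N : ℕ)
    (hs : ∀ t < N, S t i ≠ 0 ∧ Exec x B p (S t) (H t) (S (t + 1)) (H (t + 1)))
    (hN : S N i = 0) : Exec x B (.loop i p) (S 0) (H 0) (S N) (H N) := by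
  induction N generalizing S H with
  | zero => exact .loop_zero hN
  | succ N ih =>
    obtain ⟨h0, e⟩ := hs 0 (by omega)
    exact .loop_succ h0 e
      (ih (fun t => S (t + 1)) (fun t => H (t + 1)) (fun t ht => hs (t + 1) (by omega)) hN)

theorem Runs.loop_seq {i : ℕ} (S : ℕ → ℕ → ℕ) (N : ℕ)
    (hs : ∀ t < N, S t i ≠ 0 ∧ Runs x B p (S t) (S (t + 1)))
    (hN : S N i = 0) : Runs x B (.loop i p) (S 0) (S N) := by
  induction N generalizing S with
  | zero => exact fun h => ⟨h, .loop_zero hN⟩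
  | succ N ih =>
    intro h
    obtain ⟨h0, e⟩ := hs 0 (by omega)
    obtain ⟨h₁, e₁⟩ := e h
    obtain ⟨h₂, e₂⟩ := ih (fun t => S (t + 1)) (fun t ht => hs (t + 1) (by omega)) hN h₁
    exact ⟨h₂, .loop_succ h0 e₁ e₂⟩

def Prog.clear (i : ℕ) : Prog := .loop i (.dec i)

theorem Runs.clear (i : ℕ) : Runs x B (.clear i) σ (Function.update σ i 0) := by
  have := Runs.loop_seq (x := x) (B := B) (p := .dec i) (i := i)
    (fun t => Function.update σ i (σ i - t)) (σ i) (fun t ht => ⟨by simp; omega, ?_⟩) (by simp)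
  · simpa [Prog.clear] using this
  · have := Runs.dec (x := x) (B := B) (i := i) (σ := Function.update σ i (σ i - t))
      (by simp; omega)
    simpa [Nat.sub_sub] using this

/-- Adds the register `i` to the register `o` and clears the former. -/
def Prog.move (i o : ℕ) : Prog := .loop i (.seq (.dec i) (.succ o))

theorem Runs.move {i o : ℕ} (hio : i ≠ o) (hB : σ o + σ i ≤ B) :
    Runs x B (.move i o) σ (Function.update (Function.update σ o (σ o + σ i)) i 0) := by
  have := Runs.loop_seq (x := x) (B := B) (p := .seq (.dec i) (.succ o)) (i := i)
    (fun t => Function.update (Function.update σ o (σ o + t)) i (σ i - t)) (σ i)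
    (fun t ht => ⟨by simp; omega, ?_⟩) (by simp)
  · simpa [Prog.move] using this
  · convert Runs.seq (x := x) (B := B) (Runs.dec (i := i) ?_) (Runs.succ (i := o) ?_) using 1
    · funext j
      grind
    · simp; omega
    · grind

end Runs

/-! ### A function algebra for logarithmic space -/

/-- Tuples of numbers. -/
class Ctx (Γ : Type) where
  size : ℕ
  get : Γ → ℕ → ℕ

instance : Ctx Unit := ⟨0, fun _ _ => 0⟩

instance {Γ : Type} [Ctx Γ] : Ctx (Γ × ℕ) :=
  ⟨Ctx.size Γ + 1, fun γ i => if i = Ctx.size Γ then γ.2 else Ctx.get γ.1 i⟩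

section Algebra

variable {Γ : Type} [Ctx Γ]

/-- All components are at most `M`. -/
def CtxLE (γ : Γ) (M : ℕ) : Prop := ∀ i < Ctx.size Γ, Ctx.get γ i ≤ M

theorem CtxLE.mono {γ : Γ} {M M' : ℕ} (h : CtxLE γ M) (hM : M ≤ M') : CtxLE γ M' :=
  fun i hi => (h i hi).trans hM

theorem ctxLE_prod {γ : Γ} {a M : ℕ} : CtxLE (γ, a) M ↔ CtxLE γ M ∧ a ≤ M := by
  constructor
  · refine fun h => ⟨fun i hi => ?_, ?_⟩
    · have := h i (show i < Ctx.size Γ + 1 by omega)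
      simpa [Ctx.get, hi.ne] using this
    · have := h (Ctx.size Γ) (show _ < Ctx.size Γ + 1 by omega)
      simpa [Ctx.get] using this
  · rintro ⟨h, ha⟩ i hi
    have hi : i < Ctx.size Γ + 1 := hi
    by_cases e : i = Ctx.size Γ
    · simpa [Ctx.get, e] using ha
    · simpa [Ctx.get, e] using h i (by omega)

/-- Polynomially bounded functions of the arguments and the length of the input. -/
def PolyBdd (f : List Bool → Γ → ℕ) : Prop :=
  ∃ d, ∀ x γ M, x.length + 2 ≤ M → CtxLE γ M → f x γ ≤ M ^ d

/-- The registers `v 0`, `v 1`, … hold the tuple `γ`. -/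
def Loaded (v : ℕ → ℕ) (σ : ℕ → ℕ) (γ : Γ) : Prop := ∀ i < Ctx.size Γ, σ (v i) = Ctx.get γ i

/-- The program `p` computes `f` from arguments in the registers `v i`, puts the value into the
register `o`, and uses the registers from `b` on for intermediate results. -/
def Computes (f : List Bool → Γ → ℕ) (v : ℕ → ℕ) (o b : ℕ) (p : Prog) (d : ℕ) : Prop :=
  ∀ x M γ σ, x.length + 2 ≤ M → CtxLE γ M → Loaded v σ γ → σ o = 0 → (∀ j, b ≤ j → σ j = 0) →
    Runs x (M ^ d) p σ (Function.update σ o (f x γ))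

/-- Admissible choices of registers. -/
def Alloc (Γ : Type) [Ctx Γ] (v : ℕ → ℕ) (o b : ℕ) : Prop :=
  o < b ∧ ∀ i < Ctx.size Γ, v i < b ∧ v i ≠ o

/-- Functions of the input word and of a tuple of numbers that programs can compute with
polynomially bounded registers. -/
def LS (f : List Bool → Γ → ℕ) : Prop :=
  PolyBdd f ∧ ∀ v o b, Alloc Γ v o b → ∃ p d, Computes f v o b p d

/-- The register assignment for a tuple with one more component. -/
def extend (Γ : Type) [Ctx Γ] (v : ℕ → ℕ) (a : ℕ) (i : ℕ) : ℕ := if i = Ctx.size Γ then a else v i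

theorem Loaded.extend {v σ : ℕ → ℕ} {γ : Γ} (h : Loaded v σ γ) {a m : ℕ} (ha : σ a = m) :
    Loaded (extend Γ v a) σ (γ, m) := by
  intro i hi
  have hi : i < Ctx.size Γ + 1 := hi
  by_cases e : i = Ctx.size Γ
  · simp [DistAut.extend, Ctx.get, e, ha]
  · simpa [DistAut.extend, Ctx.get, e] using h i (by omega)

theorem Alloc.extend {v : ℕ → ℕ} {o b a : ℕ} (h : Alloc Γ v o b) (ha : a < b) (hao : a ≠ o) :
    Alloc (Γ × ℕ) (extend Γ v a) o b := by
  refine ⟨h.1, fun i hi => ?_⟩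
  have hi : i < Ctx.size Γ + 1 := hi
  by_cases e : i = Ctx.size Γ
  · simp [DistAut.extend, e, ha, hao]
  · simpa [DistAut.extend, e] using h.2 i (by omega)

theorem Alloc.mono {v : ℕ → ℕ} {o b b' : ℕ} (h : Alloc Γ v o b) (hb : b ≤ b') : Alloc Γ v o b' :=
  ⟨h.1.trans_le hb, fun i hi => ⟨(h.2 i hi).1.trans_le hb, (h.2 i hi).2⟩⟩

theorem Alloc.fresh {v : ℕ → ℕ} {o b o' b' : ℕ} (h : Alloc Γ v o b) (hb : b ≤ o') (hb' : o' < b') :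
    Alloc Γ v o' b' :=
  ⟨hb', fun i hi => ⟨by have := (h.2 i hi).1; omega, by have := (h.2 i hi).1; omega⟩⟩

theorem Loaded.congr {v σ σ' : ℕ → ℕ} {γ : Γ} (h : Loaded v σ γ)
    (hσ : ∀ i < Ctx.size Γ, σ' (v i) = σ (v i)) : Loaded v σ' γ :=
  fun i hi => (hσ i hi).trans (h i hi)

theorem PolyBdd.mono {f g : List Bool → Γ → ℕ} (hg : PolyBdd g) (h : ∀ x γ, f x γ ≤ g x γ) :
    PolyBdd f :=
  let ⟨d, hd⟩ := hg
  ⟨d, fun x γ M hM hγ => (h x γ).trans (hd x γ M hM hγ)⟩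

theorem PolyBdd.const (c : ℕ) : PolyBdd fun _ (_ : Γ) => c := by
  refine ⟨c, fun x γ M hM _ => ?_⟩
  exact (Nat.lt_pow_self (n := c) (by omega : 1 < M)).le

theorem PolyBdd.add {f g : List Bool → Γ → ℕ} (hf : PolyBdd f) (hg : PolyBdd g) :
    PolyBdd fun x γ => f x γ + g x γ := by
  obtain ⟨d, hd⟩ := hf
  obtain ⟨e, he⟩ := hg
  refine ⟨d + e + 1, fun x γ M hM hγ => ?_⟩
  have h1 := hd x γ M hM hγ
  have h2 := he x γ M hM hγ
  have h3 : M ^ d ≤ M ^ (d + e) := Nat.pow_le_pow_right (by omega) (by omega)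
  have h4 : M ^ e ≤ M ^ (d + e) := Nat.pow_le_pow_right (by omega) (by omega)
  rw [pow_succ]
  nlinarith

theorem PolyBdd.mul {f g : List Bool → Γ → ℕ} (hf : PolyBdd f) (hg : PolyBdd g) :
    PolyBdd fun x γ => f x γ * g x γ := by
  obtain ⟨d, hd⟩ := hf
  obtain ⟨e, he⟩ := hg
  exact ⟨d + e, fun x γ M hM hγ => by
    rw [pow_add]; exact Nat.mul_le_mul (hd x γ M hM hγ) (he x γ M hM hγ)⟩

theorem PolyBdd.last : PolyBdd fun _ (γ : Γ × ℕ) => γ.2 :=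
  ⟨1, fun x γ M _ hγ => by rw [pow_one]; exact (ctxLE_prod.1 hγ).2⟩

theorem PolyBdd.weaken {f : List Bool → Γ → ℕ} (hf : PolyBdd f) :
    PolyBdd fun x (γ : Γ × ℕ) => f x γ.1 :=
  let ⟨d, hd⟩ := hf
  ⟨d, fun x γ M hM hγ => hd x γ.1 M hM (ctxLE_prod.1 hγ).1⟩

theorem LS.weaken {f : List Bool → Γ → ℕ} (hf : LS f) : LS fun x (γ : Γ × ℕ) => f x γ.1 := by
  refine ⟨hf.1.weaken, fun v o b hv => ?_⟩
  obtain ⟨p, d, h⟩ := hf.2 v o b ⟨hv.1, fun i hi => hv.2 i (show i < Ctx.size Γ + 1 by omega)⟩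
  refine ⟨p, d, fun x M γ σ hM hγ hσ => h x M γ.1 σ hM (ctxLE_prod.1 hγ).1 fun i hi => ?_⟩
  have := hσ i (show i < Ctx.size Γ + 1 by omega)
  simpa [Ctx.get, hi.ne] using this

theorem LS.zero : LS fun _ (_ : Γ) => 0 := by
  refine ⟨.const 0, fun v o b _ => ⟨.clear o, 0, fun x M γ σ _ _ _ h0 _ => ?_⟩⟩
  exact Runs.clear o

theorem LS.succ {f : List Bool → Γ → ℕ} (hf : LS f) : LS fun x γ => f x γ + 1 := by
  have hb : PolyBdd fun x γ => f x γ + 1 := hf.1.add (.const 1)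
  refine ⟨hb, fun v o b hv => ?_⟩
  obtain ⟨p, d, h⟩ := hf.2 v o b hv
  obtain ⟨e, he⟩ := hb
  refine ⟨.seq p (.succ o), d + e, fun x M γ σ hM hγ hσ h0 hz => ?_⟩
  have h1 : M ^ d ≤ M ^ (d + e) := Nat.pow_le_pow_right (by omega) (by omega)
  have h2 : M ^ e ≤ M ^ (d + e) := Nat.pow_le_pow_right (by omega) (by omega)
  have := (((h x M γ σ hM hγ hσ h0 hz).mono h1).seq
    (Runs.succ (i := o) (by simpa using (he x γ M hM hγ).trans h2)))
  simpa using this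

theorem LS.const (c : ℕ) : LS fun _ (_ : Γ) => c := by
  induction c with
  | zero => exact .zero
  | succ c ih => exact ih.succ

/-- Local definitions. -/
theorem LS.bind {e : List Bool → Γ → ℕ} {f : List Bool → Γ × ℕ → ℕ} (he : LS e) (hf : LS f) :
    LS fun x γ => f x (γ, e x γ) := by
  obtain ⟨⟨d₁, h₁⟩, he⟩ := he
  obtain ⟨⟨d₂, h₂⟩, hf⟩ := hf
  -- M^(d₁+1) bounds both the old arguments and the new one, so f is used with this number in the
  -- place of M and the exponents multiply.
  have hM : ∀ {M : ℕ}, 2 ≤ M → M ^ d₁ ≤ M ^ (d₁ + 1) ∧ M ≤ M ^ (d₁ + 1) := fun {M} h =>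
    ⟨Nat.pow_le_pow_right (by omega) (by omega), Nat.le_self_pow (by omega) M⟩
  refine ⟨⟨(d₁ + 1) * d₂, fun x γ M hx hγ => ?_⟩, fun v o b hv => ?_⟩
  · obtain ⟨m₁, m₂⟩ := hM (M := M) (by omega)
    rw [pow_mul]
    exact h₂ _ _ _ (by omega) (ctxLE_prod.2 ⟨hγ.mono m₂, (h₁ x γ M hx hγ).trans m₁⟩)
  · obtain ⟨p, d₃, hp⟩ := he v b (b + 1) (hv.fresh le_rfl (by omega))
    obtain ⟨q, d₄, hq⟩ := hf (extend Γ v b) o (b + 1)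
      ((hv.mono (by omega)).extend (by omega) (by have := hv.1; omega))
    refine ⟨.seq (.seq p q) (.clear b), d₃ + (d₁ + 1) * d₄, fun x M γ σ hx hγ hσ h0 hz => ?_⟩
    obtain ⟨m₁, m₂⟩ := hM (M := M) (by omega)
    have r₁ := (hp x M γ σ hx hγ hσ (hz b le_rfl) (fun j hj => hz j (by omega))).mono
      (Nat.pow_le_pow_right (by omega) (by omega) : M ^ d₃ ≤ M ^ (d₃ + (d₁ + 1) * d₄))
    have hob : o ≠ b := by have := hv.1; omega
    have r₂ := (hq x (M ^ (d₁ + 1)) (γ, e x γ) (Function.update σ b (e x γ)) (by omega)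
      (ctxLE_prod.2 ⟨hγ.mono m₂, (h₁ x γ M hx hγ).trans m₁⟩)
      ((hσ.congr fun i hi => Function.update_of_ne (by have := (hv.2 i hi).1; omega) _ _).extend
        (by simp)) (by simpa [hob] using h0)
      (fun j hj => by rw [Function.update_of_ne (by omega)]; exact hz j (by omega))).mono
      (by rw [← pow_mul]; exact Nat.pow_le_pow_right (by omega) (by omega) :
        _ ≤ M ^ (d₃ + (d₁ + 1) * d₄))
    -- By `Computes`, only the output register may change, so the auxiliary register must be
    -- restored to 0.
    have := (r₁.seq r₂).seq (Runs.clear b)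
    convert this using 1
    funext j
    have := hz b le_rfl
    grind

/-- The program for primitive recursion: `p` computes the number of rounds, `q` the initial value,
and `r` the value for the next round. -/
def Prog.natRec (p q r : Prog) (o b : ℕ) : Prog :=
  .seq (.seq (.seq p q) (.loop b (.seq (.seq (.seq (.seq r (.clear o)) (.move (b + 2) o))
    (.succ (b + 1))) (.dec b)))) (.clear (b + 1))

/-- The register contents after `t` of `N` rounds. -/
def roundState (σ : ℕ → ℕ) (R : ℕ → ℕ) (N o b t : ℕ) : ℕ → ℕ :=
  Function.update (Function.update (Function.update σ o (R t)) b (N - t)) (b + 1) t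

/-- Register b counts the remaining rounds and b + 1 the completed ones. The step program reads the
previous value in o, so it cannot write there: the new value is built in b + 2 and then moved to o.
-/
theorem Runs.natRec {x : List Bool} {B : ℕ} {p q r : Prog} {σ : ℕ → ℕ} {o b N : ℕ} {R : ℕ → ℕ}
    (hob : o < b) (z0 : σ b = 0) (z1 : σ (b + 1) = 0) (z2 : σ (b + 2) = 0)
    (hp : Runs x B p σ (Function.update σ b N))
    (hq : Runs x B q (Function.update σ b N) (Function.update (Function.update σ b N) o (R 0)))
    (hr : ∀ t < N, Runs x B r (roundState σ R N o b t)
      (Function.update (roundState σ R N o b t) (b + 2) (R (t + 1))))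
    (hN : N ≤ B) (hR : ∀ t ≤ N, R t ≤ B) :
    Runs x B (.natRec p q r o b) σ (Function.update σ o (R N)) := by
  have h₀ : Function.update (Function.update σ b N) o (R 0) = roundState σ R N o b 0 := by
    funext j
    simp only [roundState, Function.update_apply]
    split_ifs <;> subst_vars <;> omega
  have h₁ : Function.update σ o (R N) =
      Function.update (roundState σ R N o b N) (b + 1) 0 := by
    funext j
    simp only [roundState, Function.update_apply]
    split_ifs <;> subst_vars <;> omega
  rw [h₀] at hq
  rw [h₁]
  refine ((hp.seq hq).seq (Runs.loop_seq (roundState σ R N o b) N (fun t ht => ⟨?_, ?_⟩) ?_)).seq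
    (Runs.clear (b + 1))
  · simp [roundState]; omega
  · have hRt := hR (t + 1) ht
    have hrt := hr t ht
    set S := roundState σ R N o b t with hS
    have S0 : S b = N - t := by simp [hS, roundState]
    have S1 : S (b + 1) = t := by simp [hS, roundState]
    have S2 : S (b + 2) = 0 := by
      simp only [hS, roundState, Function.update_apply]
      split_ifs <;> omega
    have h₂ : roundState σ R N o b (t + 1) = Function.update (Function.update (Function.update S o
        (R (t + 1))) (b + 1) (t + 1)) b (N - t - 1) := by
      funext j
      simp only [hS, roundState, Function.update_apply]
      split_ifs <;> omega
    rw [h₂]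
    clear_value S
    convert (((hrt.seq (Runs.clear o)).seq (Runs.move (i := b + 2) (o := o) (by omega) ?_)).seq
      (Runs.succ (i := b + 1) ?_)).seq (Runs.dec (i := b) ?_) using 1
    · clear hrt hr hp hq
      funext j
      simp only [Function.update_apply]
      split_ifs <;> subst_vars <;> omega
    · simp only [Function.update_apply]
      split_ifs <;> omega
    · simp only [Function.update_apply]
      split_ifs <;> omega
    · simp only [Function.update_apply]
      split_ifs <;> omega
  · simp [roundState]

/-- Polynomially bounded primitive recursion. -/
theorem LS.natRec {n g : List Bool → Γ → ℕ} {f : List Bool → Γ → ℕ → ℕ → ℕ}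
    {B : List Bool → Γ → ℕ} (hn : LS n) (hg : LS g)
    (hf : LS fun x (γ : (Γ × ℕ) × ℕ) => f x γ.1.1 γ.1.2 γ.2) (hB : PolyBdd B)
    (hle : ∀ x γ i, i ≤ n x γ →
      Nat.rec (motive := fun _ => ℕ) (g x γ) (fun i a => f x γ i a) i ≤ B x γ) :
    LS fun x γ => Nat.rec (motive := fun _ => ℕ) (g x γ) (fun i a => f x γ i a) (n x γ) := by
  refine ⟨hB.mono fun x γ => hle x γ _ le_rfl, fun v o b hv => ?_⟩
  obtain ⟨⟨dn, bn⟩, hn⟩ := hn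
  obtain ⟨dB, hB⟩ := hB
  obtain ⟨-, hg⟩ := hg
  obtain ⟨-, hf⟩ := hf
  have hob := hv.1
  obtain ⟨p, d₁, hp⟩ := hn v b (b + 3) (hv.fresh le_rfl (by omega))
  obtain ⟨q, d₂, hq⟩ := hg v o (b + 3) (hv.mono (by omega))
  obtain ⟨r, d₃, hr⟩ := hf (extend (Γ × ℕ) (extend Γ v (b + 1)) o) (b + 2) (b + 3)
    (((hv.fresh (by omega) (by omega)).extend (by omega) (by omega)).extend (by omega) (by omega))
  refine ⟨.natRec p q r o b, d₁ + d₂ + (dn + dB + 1) * d₃ + dn + dB,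
    fun x M γ σ hx hγ hσ h0 hz => ?_⟩
  have hpow : ∀ {d}, d ≤ d₁ + d₂ + (dn + dB + 1) * d₃ + dn + dB →
    M ^ d ≤ M ^ (d₁ + d₂ + (dn + dB + 1) * d₃ + dn + dB) :=
    fun h => Nat.pow_le_pow_right (by omega) h
  have hvb : ∀ i < Ctx.size Γ, v i < b ∧ v i ≠ o := hv.2
  have bN := bn x γ M hx hγ
  have m₁ : M ≤ M ^ (dn + dB + 1) := Nat.le_self_pow (by omega) M
  have m₂ : M ^ dn ≤ M ^ (dn + dB + 1) := Nat.pow_le_pow_right (by omega) (by omega)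
  have m₃ : M ^ dB ≤ M ^ (dn + dB + 1) := Nat.pow_le_pow_right (by omega) (by omega)
  refine Runs.natRec (N := n x γ)
    (R := fun t => Nat.rec (motive := fun _ => ℕ) (g x γ) (fun i a => f x γ i a) t) hob
    (hz b le_rfl) (hz (b + 1) (by omega)) (hz (b + 2) (by omega))
    ((hp x M γ σ hx hγ hσ (hz b le_rfl) (fun j hj => hz j (by omega))).mono (hpow (by omega)))
    ((hq x M γ (Function.update σ b (n x γ)) hx hγ
      (hσ.congr fun i hi => Function.update_of_ne (hvb i hi).1.ne _ _)
      (by rwa [Function.update_of_ne hob.ne])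
      (fun j hj => by rw [Function.update_of_ne (by omega)]; exact hz j (by omega))).mono
      (hpow (by omega)))
    (fun t ht => ?_) (bN.trans (hpow (by omega)))
    (fun t ht => ((hle x γ t ht).trans (hB x γ M hx hγ)).trans (hpow (by omega)))
  refine (hr x (M ^ (dn + dB + 1)) ((γ, t), _) _ (by omega)
    (ctxLE_prod.2 ⟨ctxLE_prod.2 ⟨hγ.mono m₁, by omega⟩,
      ((hle x γ t ht.le).trans (hB x γ M hx hγ)).trans m₃⟩)
    (((hσ.congr fun i hi => ?_).extend (by simp [roundState])).extend ?_) ?_ (fun j hj => ?_)).mono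
    (by rw [← pow_mul]; exact hpow (by omega))
  · have := hvb i hi
    simp only [roundState, Function.update_apply]
    split_ifs <;> omega
  · simp [roundState, hob.ne, show o ≠ b + 1 by omega]
  · have := hz (b + 2) (by omega)
    simp only [roundState, Function.update_apply]
    split_ifs <;> omega
  · have := hz j (by omega)
    simp only [roundState, Function.update_apply]
    split_ifs <;> omega

/-- Copies the register `a` to `o`, by means of the register `b`. -/
def Prog.copy (a o b : ℕ) : Prog :=
  .seq (.loop a (.seq (.seq (.dec a) (.succ b)) (.succ o))) (.move b a)

theorem Runs.copy {x : List Bool} {B : ℕ} {σ : ℕ → ℕ} {a o b : ℕ} (hab : a ≠ b) (hao : a ≠ o)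
    (hob : o ≠ b) (ho : σ o = 0) (hb : σ b = 0) (hB : σ a ≤ B) :
    Runs x B (.copy a o b) σ (Function.update σ o (σ a)) := by
  have := Runs.loop_seq (x := x) (B := B) (p := .seq (.seq (.dec a) (.succ b)) (.succ o)) (i := a)
    (fun t => Function.update (Function.update (Function.update σ b t) o t) a (σ a - t)) (σ a)
    (fun t ht => ⟨by simp; omega, ?_⟩) (by simp)
  · have h2 := this.seq (Runs.move (i := b) (o := a) hab.symm (by grind))
    refine cast (congrArg₂ (Runs x B _) ?_ ?_) h2
    · funext j; grind
    · funext j; grind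
  · convert Runs.seq (x := x) (B := B) (Runs.seq (Runs.dec (i := a) ?_) (Runs.succ (i := b) ?_))
      (Runs.succ (i := o) ?_) using 1
    · funext j
      grind
    · grind
    · grind
    · grind

/-- Together with `LS.weaken` this yields all projections: tuples act as de Bruijn contexts, with
the innermost variable as the last component. -/
theorem LS.last : LS fun _ (γ : Γ × ℕ) => γ.2 := by
  refine ⟨.last, fun v o b hv => ?_⟩
  obtain ⟨ha, hao⟩ := hv.2 (Ctx.size Γ) (show Ctx.size Γ < Ctx.size Γ + 1 by omega)
  refine ⟨.copy (v (Ctx.size Γ)) o b, 1, fun x M γ σ hx hγ hσ h0 hz => ?_⟩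
  have hs : σ (v (Ctx.size Γ)) = γ.2 := by
    have := hσ (Ctx.size Γ) (show Ctx.size Γ < Ctx.size Γ + 1 by omega)
    simpa [Ctx.get] using this
  change Runs x _ _ σ (Function.update σ o γ.2)
  rw [← hs]
  refine Runs.copy ha.ne hao hv.1.ne h0 (hz b le_rfl) ?_
  rw [hs, pow_one]
  exact (ctxLE_prod.1 hγ).2

def isOne : InputSymbol → Bool
  | .bit b => b
  | _ => false

def isBit : InputSymbol → Bool
  | .bit _ => true
  | _ => false

theorem isOne_inputSymbol (x : List Bool) (i : ℕ) :
    isOne (inputSymbol x (i + 1)) = true ↔ x[i]? = some true := by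
  simp only [inputSymbol]
  cases x[i]? <;> simp [isOne]

theorem isBit_inputSymbol (x : List Bool) (i : ℕ) :
    isBit (inputSymbol x (i + 1)) = true ↔ i < x.length := by
  simp only [inputSymbol]
  cases h : x[i]? <;> simp [isBit]
  · simpa using h
  · by_contra h'
    rw [List.getElem?_eq_none (by omega)] at h
    simp at h

/-- Adds the `a`-th bit of the input to the register `o`, by means of the register `b`. -/
def Prog.readBit (a o b : ℕ) : Prog :=
  .seq (.seq (.seq (.seq .home .right) (.loop a (.seq (.seq (.dec a) (.succ b)) .right)))
    (.move b a)) (.inc isOne o)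

/-- Bit i is in cell i + 1, so the head goes to cell 1 and then i times to the right. If i is too
large, it stops at the right end marker, which does not count as a 1, in accordance with `x[i]? =
none`. -/
theorem LS.bit_last : LS fun x (γ : Γ × ℕ) => if x[γ.2]? = some true then 1 else 0 := by
  refine ⟨(PolyBdd.const 1).mono fun x γ => by split_ifs <;> omega, fun v o b hv => ?_⟩
  obtain ⟨ha, hao⟩ := hv.2 (Ctx.size Γ) (show Ctx.size Γ < Ctx.size Γ + 1 by omega)
  have hob := hv.1
  refine ⟨.readBit (v (Ctx.size Γ)) o b, 1, fun x M γ σ hx hγ hσ h0 hz h => ?_⟩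
  have hs : σ (v (Ctx.size Γ)) = γ.2 := by
    have := hσ (Ctx.size Γ) (show Ctx.size Γ < Ctx.size Γ + 1 by omega)
    simpa [Ctx.get] using this
  have hM := (ctxLE_prod.1 hγ).2
  rw [pow_one]
  generalize v (Ctx.size Γ) = a at *
  have e₁ : Exec x M (.seq .home .right) σ h σ 1 := by
    simpa using Exec.seq (Exec.home (x := x) (B := M) (σ := σ) (h := h)) Exec.right
  have hzb := hz b le_rfl
  have e₂ := Exec.loop_seq (x := x) (B := M) (p := .seq (.seq (.dec a) (.succ b)) .right) (i := a)
    (fun t => Function.update (Function.update σ b t) a (γ.2 - t))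
    (fun t => min (t + 1) (x.length + 1)) γ.2 (fun t ht => ⟨by simp; omega, ?_⟩) (by simp)
  · have e₃ := Exec.loop_seq (x := x) (B := M) (p := .seq (.dec b) (.succ a)) (i := b)
      (fun t => Function.update (Function.update σ a t) b (γ.2 - t))
      (fun _ => min (γ.2 + 1) (x.length + 1)) γ.2 (fun t ht => ⟨by simp; omega, ?_⟩) (by simp)
    · have c₁ : Function.update (Function.update σ b 0) a (γ.2 - 0) = σ := by
        funext j
        simp only [Function.update_apply]
        split_ifs <;> subst_vars <;> omega
      have c₂ : Function.update (Function.update σ a 0) b (γ.2 - 0) =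
          Function.update (Function.update σ b γ.2) a (γ.2 - γ.2) := by
        funext j
        simp only [Function.update_apply]
        split_ifs <;> subst_vars <;> omega
      have c₃ : Function.update (Function.update σ a γ.2) b (γ.2 - γ.2) = σ := by
        funext j
        simp only [Function.update_apply]
        split_ifs <;> subst_vars <;> omega
      simp only [c₁, zero_add] at e₂
      simp only [c₂, c₃] at e₃
      rw [min_eq_left (by omega)] at e₂
      have e₄ := Exec.inc (x := x) (B := M) (c := isOne) (i := o) (σ := σ)
        (h := min (γ.2 + 1) (x.length + 1)) (fun _ => by omega)
      refine ⟨min (γ.2 + 1) (x.length + 1), (e₁.seq e₂ |>.seq e₃).seq ?_⟩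
      convert e₄ using 1
      by_cases hl : γ.2 ≤ x.length
      · rw [min_eq_left (by omega)]
        simp only [isOne_inputSymbol, h0, zero_add]
        split_ifs
        · rfl
        · simp [← h0]
      · rw [min_eq_right (by omega)]
        simp [isOne_inputSymbol, List.getElem?_eq_none (show x.length ≤ γ.2 by omega), ← h0]
    · convert Exec.seq (Exec.dec (x := x) (B := M) (i := b) ?_) (Exec.succ (i := a) ?_) using 1
      · funext j
        simp only [Function.update_apply]
        split_ifs <;> subst_vars <;> omega
      · simp; omega
      · simp only [Function.update_apply]
        split_ifs <;> omega
  · have : min (t + 1 + 1) (x.length + 1) = min (min (t + 1) (x.length + 1) + 1) (x.length + 1) := by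
      omega
    rw [this]
    convert Exec.seq (Exec.seq (Exec.dec (x := x) (B := M) (i := a) ?_) (Exec.succ (i := b) ?_))
      Exec.right using 1
    · funext j
      simp only [Function.update_apply]
      split_ifs <;> omega
    · simp; omega
    · simp only [Function.update_apply]
      split_ifs <;> omega

/-- Puts the length of the input into the register `o`, by means of the register `b`. -/
def Prog.length (o b : ℕ) : Prog :=
  .seq (.seq .home (.succ b))
    (.loop b (.seq (.seq (.seq .right (.dec b)) (.inc isBit b)) (.inc isBit o)))

theorem LS.length : LS fun x (_ : Γ) => x.length := by
  refine ⟨⟨1, fun x γ M hx _ => by rw [pow_one]; exact (Nat.le_add_right _ 2).trans hx⟩, fun v o b hv => ?_⟩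
  refine ⟨.length o b, 1, fun x M γ σ hx hγ hσ h0 hz h => ?_⟩
  have hob := hv.1
  have hzb := hz b le_rfl
  rw [pow_one]
  have e₁ : Exec x M (.seq .home (.succ b)) σ h (Function.update σ b 1) 0 := by
    have := Exec.seq (Exec.home (x := x) (B := M) (σ := σ) (h := h)) (Exec.succ (i := b) (by omega))
    simpa [hzb] using this
  -- Register b is a flag: the truncated difference below is 1 for t ≤ |x| and 0 for t = |x| + 1,
  -- when the head reaches the right end marker. That last round does not increase o.
  have e₂ := Exec.loop_seq (x := x) (B := M)
    (p := .seq (.seq (.seq .right (.dec b)) (.inc isBit b)) (.inc isBit o)) (i := b)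
    (fun t => Function.update (Function.update σ b (x.length + 1 - t - (x.length - t))) o
      (min t x.length)) (fun t => min t (x.length + 1)) (x.length + 1)
    (fun t ht => ⟨by simp [hob.ne']; omega, ?_⟩) (by simp [hob.ne'])
  · have c₁ : Function.update (Function.update σ b (x.length + 1 - 0 - (x.length - 0))) o
        (min 0 x.length) = Function.update σ b 1 := by
      funext j
      simp only [Function.update_apply]
      split_ifs <;> subst_vars <;> omega
    have c₂ : Function.update (Function.update σ b (x.length + 1 - (x.length + 1) -
        (x.length - (x.length + 1)))) o (min (x.length + 1) x.length) =
        Function.update σ o x.length := by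
      funext j
      simp only [Function.update_apply]
      split_ifs <;> subst_vars <;> omega
    beta_reduce at e₂
    rw [c₁, c₂, Nat.zero_min] at e₂
    exact ⟨_, e₁.seq e₂⟩
  · rw [min_eq_left (show t ≤ x.length + 1 by omega),
      min_eq_left (show t + 1 ≤ x.length + 1 by omega)]
    have e₃ := Exec.right (x := x) (B := M) (σ := Function.update (Function.update σ b
      (x.length + 1 - t - (x.length - t))) o (min t x.length)) (h := t)
    rw [min_eq_left (show t + 1 ≤ x.length + 1 by omega)] at e₃
    have hbit := isBit_inputSymbol x t
    convert ((e₃.seq (Exec.dec (i := b) ?_)).seq (Exec.inc (c := isBit) (i := b) ?_)).seq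
      (Exec.inc (c := isBit) (i := o) ?_) using 1
    · simp only [hbit]
      funext j
      by_cases ht' : t < x.length
      · simp only [if_pos ht', Function.update_apply]
        split_ifs <;> omega
      · simp only [if_neg ht', Function.update_apply]
        split_ifs <;> omega
    · simp [hob.ne']; omega
    · simp [hob.ne']; omega
    · simp only [hbit]
      intro ht'
      simp only [if_pos ht', Function.update_apply]
      split_ifs <;> omega

end Algebra

/-! ### Arithmetic, predicates and bounded search in the algebra -/

section Derived

variable {Γ : Type} [Ctx Γ]

theorem LS.congr {f g : List Bool → Γ → ℕ} (hf : LS f) (h : ∀ x γ, f x γ = g x γ) : LS g := by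
  obtain rfl : f = g := funext fun x => funext fun γ => h x γ
  exact hf

theorem LS.add {f g : List Bool → Γ → ℕ} (hf : LS f) (hg : LS g) :
    LS fun x γ => f x γ + g x γ := by
  have key : ∀ x γ i, Nat.rec (motive := fun _ => ℕ) (f x γ) (fun _ a => a + 1) i = f x γ + i := by
    intro x γ i
    induction i with
    | zero => rfl
    | succ i ih => simp only [ih, add_assoc]
  refine (LS.natRec (f := fun _ _ _ a => a + 1) hg hf LS.last.succ (hf.1.add hg.1)
    fun x γ i hi => ?_).congr fun x γ => key x γ _
  rw [key]
  omega

theorem LS.mul {f g : List Bool → Γ → ℕ} (hf : LS f) (hg : LS g) :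
    LS fun x γ => f x γ * g x γ := by
  have key : ∀ x γ i, Nat.rec (motive := fun _ => ℕ) 0 (fun _ a => a + f x γ) i = f x γ * i := by
    intro x γ i
    induction i with
    | zero => rfl
    | succ i ih => simp only [ih, mul_add, mul_one]
  refine (LS.natRec (f := fun x γ _ a => a + f x γ) hg .zero (LS.last.add hf.weaken.weaken)
    (hf.1.mul hg.1) fun x γ i hi => ?_).congr fun x γ => key x γ _
  rw [key]
  exact Nat.mul_le_mul_left _ hi

theorem LS.pred {f : List Bool → Γ → ℕ} (hf : LS f) : LS fun x γ => f x γ - 1 := by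
  have key : ∀ i, Nat.rec (motive := fun _ => ℕ) 0 (fun i _ => i) i = i - 1 := by
    intro i
    cases i <;> rfl
  refine (LS.natRec (f := fun _ _ i _ => i) hf .zero LS.last.weaken hf.1
    fun x γ i hi => ?_).congr fun x γ => key _
  rw [key]
  omega

theorem LS.sub {f g : List Bool → Γ → ℕ} (hf : LS f) (hg : LS g) :
    LS fun x γ => f x γ - g x γ := by
  have key : ∀ x γ i, Nat.rec (motive := fun _ => ℕ) (f x γ) (fun _ a => a - 1) i = f x γ - i := by
    intro x γ i
    induction i with
    | zero => rfl
    | succ i ih => simp only [ih, Nat.sub_sub]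
  refine (LS.natRec (f := fun _ _ _ a => a - 1) hg hf LS.last.pred hf.1
    fun x γ i hi => ?_).congr fun x γ => key x γ _
  rw [key]
  omega

open Classical in
/-- Predicates whose characteristic function belongs to `LS`. -/
def LSP (P : List Bool → Γ → Prop) : Prop := LS fun x γ => if P x γ then 1 else 0

theorem LSP.congr {P Q : List Bool → Γ → Prop} (hP : LSP P) (h : ∀ x γ, P x γ ↔ Q x γ) :
    LSP Q := by
  obtain rfl : P = Q := funext fun x => funext fun γ => propext (h x γ)
  exact hP

theorem LSP.weaken {P : List Bool → Γ → Prop} (hP : LSP P) : LSP fun x (γ : Γ × ℕ) => P x γ.1 :=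
  LS.weaken hP

-- Case distinction is a recursion with the characteristic function as number of rounds: no round
-- leaves the value of g, one round replaces it by that of f.
open Classical in
theorem LS.ite {P : List Bool → Γ → Prop} {f g : List Bool → Γ → ℕ} (hP : LSP P) (hf : LS f)
    (hg : LS g) : LS fun x γ => if P x γ then f x γ else g x γ := by
  refine (LS.natRec (f := fun x γ _ _ => f x γ) hP hg hf.weaken.weaken (hf.1.add hg.1)
    fun x γ i hi => ?_).congr fun x γ => ?_
  · cases i <;> simp
  · split_ifs <;> rfl

theorem LSP.pos {f : List Bool → Γ → ℕ} (hf : LS f) : LSP fun x γ => 0 < f x γ := by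
  have key : ∀ i, Nat.rec (motive := fun _ => ℕ) 0 (fun _ _ => 1) i = if 0 < i then 1 else 0 := by
    intro i
    cases i <;> simp
  refine (LS.natRec (f := fun _ _ _ _ => 1) hf .zero (.const 1) (.const 1)
    fun x γ i hi => ?_).congr fun x γ => (key _).trans (by congr)
  cases i <;> simp

theorem LSP.lt {f g : List Bool → Γ → ℕ} (hf : LS f) (hg : LS g) :
    LSP fun x γ => f x γ < g x γ :=
  (LSP.pos (hg.sub hf)).congr fun x γ => by omega

theorem LSP.not {P : List Bool → Γ → Prop} (hP : LSP P) : LSP fun x γ => ¬ P x γ := by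
  classical
  refine (LS.sub (.const 1) hP).congr fun x γ => ?_
  by_cases h : P x γ <;> simp [h]

theorem LSP.and {P Q : List Bool → Γ → Prop} (hP : LSP P) (hQ : LSP Q) :
    LSP fun x γ => P x γ ∧ Q x γ := by
  classical
  refine (LS.mul hP hQ).congr fun x γ => ?_
  by_cases h : P x γ <;> by_cases h' : Q x γ <;> simp [h, h']

theorem LSP.imp {P Q : List Bool → Γ → Prop} (hP : LSP P) (hQ : LSP Q) :
    LSP fun x γ => P x γ → Q x γ :=
  (hP.and hQ.not).not.congr fun x γ => by tauto

theorem LSP.iff {P Q : List Bool → Γ → Prop} (hP : LSP P) (hQ : LSP Q) :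
    LSP fun x γ => P x γ ↔ Q x γ :=
  ((hP.imp hQ).and (hQ.imp hP)).congr fun x γ => by tauto

theorem LSP.eq {f g : List Bool → Γ → ℕ} (hf : LS f) (hg : LS g) :
    LSP fun x γ => f x γ = g x γ :=
  ((LSP.lt hf hg).not.and (LSP.lt hg hf).not).congr fun x γ => by omega

/-- Bounded existential quantification. -/
theorem LSP.exists_lt {n : List Bool → Γ → ℕ} {P : List Bool → Γ → ℕ → Prop} (hn : LS n)
    (hP : LSP fun x (γ : Γ × ℕ) => P x γ.1 γ.2) : LSP fun x γ => ∃ i < n x γ, P x γ i := by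
  classical
  have key : ∀ x γ k, Nat.rec (motive := fun _ => ℕ) 0 (fun i a => if P x γ i then 1 else a) k =
      if ∃ i < k, P x γ i then 1 else 0 := by
    intro x γ k
    induction k with
    | zero => simp
    | succ k ih =>
      simp only [ih, Nat.lt_succ_iff_lt_or_eq, or_and_right, exists_or, exists_eq_left]
      by_cases h : P x γ k <;> simp [h]
  refine (LS.natRec (f := fun x γ i a => if P x γ i then 1 else a) hn .zero
    (LS.ite hP.weaken (.const 1) .last) (.const 1) fun x γ i hi => ?_).congr fun x γ => (key x γ _).trans ?_
  · rw [key]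
    split_ifs <;> omega
  · congr

theorem LSP.forall_lt {n : List Bool → Γ → ℕ} {P : List Bool → Γ → ℕ → Prop} (hn : LS n)
    (hP : LSP fun x (γ : Γ × ℕ) => P x γ.1 γ.2) : LSP fun x γ => ∀ i < n x γ, P x γ i :=
  (LSP.exists_lt (P := fun x γ i => ¬ P x γ i) hn hP.not).not.congr fun x γ => by push Not; rfl

open Classical in
/-- Bounded search. -/
theorem LS.findGreatest {n : List Bool → Γ → ℕ} {P : List Bool → Γ → ℕ → Prop} (hn : LS n)
    (hP : LSP fun x (γ : Γ × ℕ) => P x γ.1 γ.2) :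
    LS fun x γ => Nat.findGreatest (P x γ) (n x γ) := by
  have key : ∀ x γ k, Nat.rec (motive := fun _ => ℕ) 0
      (fun i a => if P x γ i then i else a) k = Nat.findGreatest (P x γ) (k - 1) := by
    intro x γ k
    induction k with
    | zero => rfl
    | succ k ih =>
      simp only [ih]
      cases k with
      | zero => simp
      | succ k => rw [Nat.add_sub_cancel, Nat.add_sub_cancel, Nat.findGreatest_succ]
  refine (LS.natRec (f := fun x γ i a => if P x γ i then i else a) hn.succ .zero
    (LS.ite hP.weaken LS.last.weaken .last) hn.1 fun x γ i hi => ?_).congr fun x γ => key x γ (n x γ + 1)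
  rw [key]
  exact (Nat.findGreatest_le _).trans (by omega)

theorem LS.half {f : List Bool → Γ → ℕ} (hf : LS f) : LS fun x γ => f x γ / 2 := by
  refine (LS.findGreatest (P := fun x γ i => ¬ f x γ < 2 * i) hf
    (LSP.lt hf.weaken (LS.mul (.const 2) .last)).not).congr fun x γ => ?_
  have : Nat.findGreatest (fun i => ¬ f x γ < 2 * i) (f x γ) = f x γ / 2 :=
    Nat.findGreatest_eq_iff.2 ⟨by omega, fun _ => by omega, fun i h1 h2 => by omega⟩
  convert this

/-- Right shift. -/
theorem LS.div_two_pow {f g : List Bool → Γ → ℕ} (hf : LS f) (hg : LS g) :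
    LS fun x γ => f x γ / 2 ^ g x γ := by
  -- Halving is iterated because the power of two itself need not be polynomially bounded, whereas
  -- all intermediate quotients are.
  have key : ∀ x γ i, Nat.rec (motive := fun _ => ℕ) (f x γ) (fun _ a => a / 2) i =
      f x γ / 2 ^ i := by
    intro x γ i
    induction i with
    | zero => simp
    | succ i ih => simp only [ih, pow_succ, Nat.div_div_eq_div_mul]
  refine (LS.natRec (f := fun _ _ _ a => a / 2) hg hf LS.last.half hf.1
    fun x γ i hi => ?_).congr fun x γ => key x γ _
  rw [key]
  exact Nat.div_le_self _ _

theorem LSP.testBit {f g : List Bool → Γ → ℕ} (hf : LS f) (hg : LS g) :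
    LSP fun x γ => (f x γ).testBit (g x γ) = true := by
  have h := LS.div_two_pow hf hg
  refine (LSP.eq (h.sub (LS.mul (.const 2) h.half)) (.const 1)).congr fun x γ => ?_
  rw [Nat.testBit_eq_decide_div_mod_eq, decide_eq_true_iff]
  omega

theorem LSP.bit {f : List Bool → Γ → ℕ} (hf : LS f) : LSP fun x γ => x[f x γ]? = some true := by
  classical
  exact (LS.bind hf LS.bit_last).congr fun x γ => by congr

/-- A predicate in `LS` is decided in logarithmic space. -/
theorem LSP.inLogSpace {X : Set (List Bool)} (h : LSP fun x (_ : Unit) => x ∈ X) :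
    InLogSpace X := by
  classical
  obtain ⟨p, d, hp⟩ := h.2 id 0 1 ⟨one_pos, fun i hi => absurd hi (Nat.not_lt_zero i)⟩
  refine inLogSpace_of_exec (p := p) (d := d) fun x => ?_
  obtain ⟨h', e⟩ := hp x (x.length + 2) () (fun _ => 0) le_rfl
    (fun i hi => absurd hi (Nat.not_lt_zero i)) (fun i hi => absurd hi (Nat.not_lt_zero i)) rfl
    (fun _ _ => rfl) 0
  exact ⟨_, h', e, by simp⟩

end Derived

/-! ### Reachable sets of states -/

namespace DistributedAutomaton

variable {Sym : Type} {r : ℕ} {Q : Type} (A : DistributedAutomaton Sym r Q)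

/-- The states that a forgetful automaton can enter if the neighbors are in states from `S`. -/
def nextSet (S : Set Q) : Set Q := {q | ∃ a N, (∀ k, N k ⊆ S) ∧ A.trans a A.init N = q}

/-- The states that nodes of digraphs can be in at time `t`. -/
def reachSet : ℕ → Set Q
  | 0 => {A.init}
  | t + 1 => A.nextSet (reachSet t)

variable {A}

theorem run_mem_reachSet (hA : A.IsForgetful) (G : LabeledDigraph Sym r) (t : ℕ) (v : G.Node) :
    A.run G t v ∈ A.reachSet t := by
  induction t generalizing v with
  | zero => rfl
  | succ t ih =>
    refine ⟨G.label v, _, fun k => ?_, hA _ _ _ _⟩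
    rintro q ⟨u, -, rfl⟩
    exact ih u

/-- The disjoint union of pointed digraphs `P q`, with a new node whose incoming `k`-neighbors are
the points of those `P q` with `q ∈ N k`. -/
def joinGraph [Finite Q] (P : Q → PointedDigraph Sym r) (N : Fin r → Set Q) (a : Sym) :
    LabeledDigraph Sym r where
  Node := Option (Σ q, (P q).graph.Node)
  finite := by
    have := fun q => (P q).graph.finite
    infer_instance
  nonempty := ⟨none⟩
  edge := fun k u v => match u, v with
    | some ⟨q, u⟩, some v => ∃ v', (P q).graph.edge k u v' ∧ v = ⟨q, v'⟩
    | some ⟨q, u⟩, none => u = (P q).point ∧ q ∈ N k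
    | none, _ => False
  label := fun v => match v with
    | none => a
    | some ⟨q, v⟩ => (P q).graph.label v

/-- All edges into an old node come from its own component, so the components run undisturbed. -/
theorem run_joinGraph_some [Finite Q] (P : Q → PointedDigraph Sym r) (N : Fin r → Set Q) (a : Sym)
    (t : ℕ) (q : Q) (v : (P q).graph.Node) :
    A.run (joinGraph P N a) t (some ⟨q, v⟩) = A.run (P q).graph t v := by
  induction t generalizing q v with
  | zero => rfl
  | succ t ih =>
    simp only [run]
    rw [ih]
    congr 1
    funext k
    ext q'
    constructor
    · rintro ⟨u, hu, rfl⟩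
      match u, hu with
      | some ⟨p, u⟩, ⟨v', hv, e⟩ =>
        obtain ⟨rfl, h⟩ := Sigma.mk.inj e
        obtain rfl := eq_of_heq h
        exact ⟨u, hv, (ih _ _).symm⟩
    · rintro ⟨u, hu, rfl⟩
      exact ⟨some ⟨q, u⟩, ⟨v, hu, rfl⟩, ih _ _⟩

theorem exists_run_eq [Finite Q] [Nonempty Sym] (hA : A.IsForgetful) (t : ℕ) {q : Q}
    (hq : q ∈ A.reachSet t) :
    ∃ P : PointedDigraph Sym r, A.run P.graph t P.point = q := by
  induction t generalizing q with
  | zero =>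
    refine ⟨⟨⟨Unit, inferInstance, inferInstance, fun _ _ _ => False,
      fun _ => Classical.arbitrary Sym⟩, ()⟩, ?_⟩
    exact (Set.mem_singleton_iff.1 hq).symm
  | succ t ih =>
    obtain ⟨a, N, hN, rfl⟩ := hq
    -- `joinGraph` needs a digraph for every state; unreachable states get a dummy, whose point has
    -- no edge to the new node because N k ⊆ `A.reachSet t`.
    have : ∀ q, ∃ P : PointedDigraph Sym r, q ∈ A.reachSet t → A.run P.graph t P.point = q := by
      intro q
      by_cases h : q ∈ A.reachSet t
      · exact (ih h).imp fun P hP _ => hP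
      · exact ⟨⟨⟨Unit, inferInstance, inferInstance, fun _ _ _ => False,
          fun _ => Classical.arbitrary Sym⟩, ()⟩, fun h' => absurd h' h⟩
    choose P hP using this
    refine ⟨⟨joinGraph P N a, none⟩, ?_⟩
    simp only [run]
    -- Forgetfulness is essential here: nothing is known about the state of the new node at time t.
    rw [hA _ _ A.init]
    congr 1
    funext k
    ext q
    constructor
    · rintro ⟨u, hu, rfl⟩
      match u, hu with
      | some ⟨p, u⟩, ⟨hu, hp⟩ =>
        obtain rfl : u = (P p).point := hu
        rw [run_joinGraph_some, hP p (hN k hp)]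
        exact hp
    · intro hq
      exact ⟨some ⟨q, (P q).point⟩, ⟨rfl, hq⟩, by rw [run_joinGraph_some, hP q (hN k hq)]⟩

end DistributedAutomaton

/-- A property that occurs in the orbit of a point of a finite set occurs early. -/
theorem exists_lt_card_of_orbit {α : Type} [Finite α] {g : α → α} {u : ℕ → α}
    (hu : ∀ t, u (t + 1) = g (u t)) {p : α → Prop} (h : ∃ t, p (u t)) :
    ∃ t < Nat.card α, p (u t) := by
  classical
  have hshift : ∀ {i j}, u i = u j → ∀ d, u (i + d) = u (j + d) := by
    intro i j e d
    induction d with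
    | zero => exact e
    | succ d ih => rw [← add_assoc, ← add_assoc, hu, hu, ih]
  refine ⟨Nat.find h, ?_, Nat.find_spec h⟩
  by_contra hlt
  have hlt := not_lt.1 hlt
  -- A repetition up to the first occurrence could be cut out, which would give an earlier
  -- occurrence.
  have hne : ∀ i j, i < j → j ≤ Nat.find h → u i ≠ u j := by
    intro i j hij hj e
    have := hshift e (Nat.find h - j)
    rw [Nat.add_sub_cancel' hj] at this
    exact Nat.find_min h (m := i + (Nat.find h - j)) (by omega) (this ▸ Nat.find_spec h)
  have hinj : Function.Injective fun i : Fin (Nat.find h + 1) => u i := by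
    intro i j e
    rcases lt_trichotomy (i : ℕ) j with hij | hij | hij
    · exact absurd e (hne i j hij (by omega))
    · exact Fin.ext hij
    · exact absurd e.symm (hne j i hij (by omega))
  have := Nat.card_le_card_of_injective _ hinj
  rw [Nat.card_fin] at this
  omega

theorem DistributedAutomaton.language_nonempty_iff {Sym : Type} [Nonempty Sym] {r n : ℕ}
    {A : DistributedAutomaton Sym r (Fin n)} (hA : A.IsForgetful) :
    A.language.Nonempty ↔ ∃ t < 2 ^ n, ∃ q ∈ A.reachSet t, q ∈ A.accept := by
  constructor
  · rintro ⟨P, t, ht⟩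
    have := exists_lt_card_of_orbit (g := A.nextSet) (u := A.reachSet) (fun t => rfl)
      (p := fun S => ∃ q ∈ S, q ∈ A.accept) ⟨t, _, A.run_mem_reachSet hA _ t _, ht⟩
    simpa using this
  · rintro ⟨t, -, q, hq, hF⟩
    obtain ⟨P, hP⟩ := A.exists_run_eq hA t hq
    exact ⟨P, t, by rw [hP]; exact hF⟩

/-! ### The layout of encodings -/

/-- The word `l` occurs in `x` at position `p`, as far as the positions of `true` are concerned. -/
def Seg (x : List Bool) (p : ℕ) (l : List Bool) : Prop :=
  ∀ i < l.length, (x[p + i]? = some true ↔ l[i]? = some true)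

theorem seg_append {x l₁ l₂ : List Bool} {p : ℕ} :
    Seg x p (l₁ ++ l₂) ↔ Seg x p l₁ ∧ Seg x (p + l₁.length) l₂ := by
  unfold Seg
  constructor
  · refine fun h => ⟨fun i hi => ?_, fun i hi => ?_⟩
    · rw [h i (by simp; omega), List.getElem?_append_left hi]
    · rw [add_assoc, h (l₁.length + i) (by simp; omega), List.getElem?_append_right (by omega)]
      simp
  · rintro ⟨h₁, h₂⟩ i hi
    by_cases h : i < l₁.length
    · rw [h₁ i h, List.getElem?_append_left h]
    · have := h₂ (i - l₁.length) (by simp at hi; omega)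
      rw [add_assoc, Nat.add_sub_cancel' (by omega)] at this
      rw [this, List.getElem?_append_right (by omega)]

/-- `Seg` does not distinguish `false` from a position behind the end of the word, so the length has
to be compared separately. -/
theorem eq_iff_seg {x l : List Bool} : l = x ↔ x.length = l.length ∧ Seg x 0 l := by
  constructor
  · rintro rfl
    exact ⟨rfl, fun i _ => by rw [zero_add]⟩
  · rintro ⟨h, hs⟩
    refine List.ext_getElem h.symm fun i h₁ h₂ => ?_
    have := hs i h₁
    rw [zero_add, List.getElem?_eq_getElem h₁, List.getElem?_eq_getElem h₂] at this
    revert this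
    cases l[i] <;> cases x[i] <;> simp

theorem seg_map_range {x : List Bool} {p m : ℕ} {f : ℕ → Bool} :
    Seg x p ((List.range m).map f) ↔ ∀ i < m, (x[p + i]? = some true ↔ f i = true) := by
  unfold Seg
  simp only [List.length_map, List.length_range]
  refine forall₂_congr fun i hi => ?_
  simp [hi]

theorem seg_flatMap {α : Type} {x : List Bool} {m : ℕ} {f : α → List Bool}
    (hf : ∀ a, (f a).length = m) (l : List α) (p : ℕ) :
    Seg x p (l.flatMap f) ↔ ∀ (i : ℕ) (h : i < l.length), Seg x (p + i * m) (f l[i]) := by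
  induction l generalizing p with
  | nil => simp [Seg]
  | cons a l ih =>
    rw [List.flatMap_cons, seg_append, ih, hf]
    constructor
    · rintro ⟨h₁, h₂⟩ i hi
      cases i with
      | zero => simpa using h₁
      | succ i =>
        have := h₂ i (by simpa using hi)
        rw [show p + (i + 1) * m = p + m + i * m by ring]
        simpa using this
    · refine fun h => ⟨by simpa using! h 0 (by simp), fun i hi => ?_⟩
      have := h (i + 1) (by simpa using hi)
      rw [show p + (i + 1) * m = p + m + i * m by ring] at this
      simpa using this

theorem seg_encodeUnary {x : List Bool} {p m : ℕ} :
    Seg x p (encodeUnary m) ↔ (∀ i < m, x[p + i]? = some true) ∧ ¬ x[p + m]? = some true := by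
  unfold encodeUnary
  rw [seg_append]
  refine and_congr ?_ ?_
  · unfold Seg
    simp only [List.length_replicate]
    refine forall₂_congr fun i hi => ?_
    simp [hi]
  · simp [Seg]

/-- The binary digits of the number `q` can be read from `x` at the positions `p, …, p + w - 1`. -/
def NumAt (x : List Bool) (w p q : ℕ) : Prop :=
  ∀ j < w, (x[p + j]? = some true ↔ q.testBit j = true)

theorem NumAt.unique {x : List Bool} {w p q q' : ℕ} (h : NumAt x w p q) (h' : NumAt x w p q')
    (hq : q < 2 ^ w) (hq' : q' < 2 ^ w) : q = q' := by
  refine Nat.eq_of_testBit_eq fun j => ?_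
  by_cases hj : j < w
  · rw [Bool.eq_iff_iff, ← h j hj, ← h' j hj]
  · have hpow : 2 ^ w ≤ 2 ^ j := Nat.pow_le_pow_right (by norm_num) (by omega)
    rw [Nat.testBit_lt_two_pow (hq.trans_le hpow), Nat.testBit_lt_two_pow (hq'.trans_le hpow)]

theorem seg_encodeState {x : List Bool} {p n : ℕ} (q : Fin n) :
    Seg x p (encodeState q) ↔ NumAt x n.size p q :=
  seg_map_range

theorem seg_encodeSet {x : List Bool} {p n : ℕ} (S : Set (Fin n)) :
    Seg x p (encodeSet S) ↔ ∀ q : Fin n, x[p + q]? = some true ↔ q ∈ S := by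
  unfold Seg encodeSet
  simp only [List.length_map, List.length_finRange]
  constructor
  · intro h q
    rw [h q q.2]
    simp
  · intro h i hi
    rw [h ⟨i, hi⟩]
    simp [hi]

theorem length_encodeTable {s r n : ℕ} (A : DistributedAutomaton (Fin s) r (Fin n)) (a : Fin s) :
    (encodeTable A a).length = 2 ^ (n * r) * n.size := by
  simp [encodeTable, encodeState, List.length_flatMap]

/-- The position of the encoding of the initial state. -/
def initPos (s r n : ℕ) : ℕ := s + 1 + (r + 1) + (n + 1)

/-- The position of the `i`-th entry of the `a`-th table, where each table has `P` entries with `w`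
bits. -/
def entryPos (s r n w P a i : ℕ) : ℕ := initPos s r n + w + n + a * (P * w) + i * w

/-- The word `x` has the size parameters `s`, `r`, `n` in unary and the appropriate length. -/
def Header (x : List Bool) (s r n w P : ℕ) : Prop :=
  x.length = initPos s r n + w + n + s * (P * w) ∧
  (∀ i < s, x[i]? = some true) ∧ ¬ x[s]? = some true ∧
  (∀ i < r, x[s + 1 + i]? = some true) ∧ ¬ x[s + 1 + r]? = some true ∧
  (∀ i < n, x[s + 1 + (r + 1) + i]? = some true) ∧ ¬ x[s + 1 + (r + 1) + n]? = some true

/-- This replaces an equation between words by bounded conditions on single bits at computable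
positions, the form in which `LSP` can handle it. It serves both to read an automaton off a word and
to verify its encoding. -/
theorem encode_eq_iff {s r n : ℕ} {A : DistributedAutomaton (Fin s) r (Fin n)} {x : List Bool} :
    encode A = x ↔ Header x s r n n.size (2 ^ (n * r)) ∧
      NumAt x n.size (initPos s r n) A.init ∧
      (∀ q : Fin n, x[initPos s r n + n.size + q]? = some true ↔ q ∈ A.accept) ∧
      ∀ a : Fin s, ∀ i < 2 ^ (n * r), NumAt x n.size (entryPos s r n n.size (2 ^ (n * r)) a i)
        (A.trans a A.init (neighborSets n r i)) := by
  have hst : ∀ q : Fin n, (encodeState q).length = n.size := fun q => by simp [encodeState]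
  have htab : ∀ p a, Seg x p (encodeTable A a) ↔ ∀ i < 2 ^ (n * r),
      NumAt x n.size (p + i * n.size) (A.trans a A.init (neighborSets n r i)) := by
    intro p a
    unfold encodeTable
    rw [seg_flatMap (m := n.size) (fun i => hst _)]
    simp [seg_encodeState]
  rw [eq_iff_seg]
  unfold encode
  simp only [seg_append, seg_encodeUnary, seg_encodeState, seg_encodeSet, Header,
    seg_flatMap (length_encodeTable A), htab, List.length_append]
  have hun : ∀ m, (encodeUnary m).length = m + 1 := fun m => by simp [encodeUnary]
  have hset : (encodeSet A.accept).length = n := by simp [encodeSet]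
  have hfl : ((List.finRange s).flatMap fun a => encodeTable A a).length =
      s * (2 ^ (n * r) * n.size) := by
    simp [List.length_flatMap, length_encodeTable]
  simp only [hun, hst, hset, hfl, zero_add, List.length_finRange, List.getElem_finRange]
  have hpos : s + 1 + (r + 1) + (n + 1) = initPos s r n := rfl
  simp only [hpos]
  constructor
  · rintro ⟨h1, ⟨⟨⟨⟨h2, h3⟩, h4⟩, h5⟩, h6⟩, h7⟩
    exact ⟨⟨h1, h2.1, h2.2, h3.1, h3.2, h4.1, h4.2⟩, h5, h6, fun a i hi => by
      simpa [entryPos] using h7 a a.2 i hi⟩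
  · rintro ⟨⟨h1, h2, h2', h3, h3', h4, h4'⟩, h5, h6, h7⟩
    exact ⟨h1, ⟨⟨⟨⟨⟨h2, h2'⟩, h3, h3'⟩, h4, h4'⟩, h5⟩, h6⟩, fun a ha i hi => by
      simpa [entryPos] using h7 ⟨a, ha⟩ i hi⟩

/-! ### Sets of states as numbers -/

theorem exists_testBit_iff (m : ℕ) (p : ℕ → Prop) :
    ∃ S < 2 ^ m, ∀ j < m, (S.testBit j = true ↔ p j) := by
  classical
  refine ⟨Nat.ofBits fun j : Fin m => decide (p j), Nat.ofBits_lt_two_pow _, fun j hj => ?_⟩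
  rw [Nat.testBit_ofBits_lt _ _ hj]
  simp

theorem mul_add_lt_mul {n r k q : ℕ} (hk : k < r) (hq : q < n) : k * n + q < n * r := by
  calc k * n + q < k * n + n := by omega
    _ = n * (k + 1) := by ring
    _ ≤ n * r := Nat.mul_le_mul_left n hk

theorem exists_neighborSets_eq {n r : ℕ} (N : Fin r → Set (Fin n)) :
    ∃ i < 2 ^ (n * r), neighborSets n r i = N := by
  obtain ⟨i, hi, h⟩ := exists_testBit_iff (n * r) fun j =>
    ∃ (k : Fin r) (q : Fin n), q ∈ N k ∧ (k : ℕ) * n + q = j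
  refine ⟨i, hi, ?_⟩
  funext k
  ext q
  simp only [neighborSets, Set.mem_ofPred_eq]
  rw [h _ (mul_add_lt_mul k.2 q.2)]
  constructor
  · rintro ⟨k', q', hq', e⟩
    have hn : 0 < n := q.pos
    have h₁ : (k' : ℕ) = k := by
      have := congrArg (· / n) e
      simpa [Nat.mul_add_div, mul_comm _ n, hn, Nat.div_eq_of_lt q.2, Nat.div_eq_of_lt q'.2]
        using this
    have h₁ := Fin.ext h₁
    subst h₁
    obtain rfl : q' = q := Fin.ext (by omega)
    exact hq'
  · exact fun hq => ⟨k, q, hq, rfl⟩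

/-- With `exists_neighborSets_eq`, table indices correspond bijectively to tuples of sets, so any
table of states defines a transition function. -/
theorem neighborSets_injOn {n r i i' : ℕ} (hi : i < 2 ^ (n * r)) (hi' : i' < 2 ^ (n * r))
    (h : neighborSets n r i = neighborSets n r i') : i = i' := by
  refine Nat.eq_of_testBit_eq fun j => ?_
  by_cases hj : j < n * r
  · have hn : 0 < n := Nat.pos_of_ne_zero (by rintro rfl; simp at hj)
    have := congrFun h ⟨j / n, Nat.div_lt_of_lt_mul hj⟩
    have := Set.ext_iff.1 this ⟨j % n, Nat.mod_lt j hn⟩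
    simp only [neighborSets, Set.mem_ofPred_eq] at this
    rwa [mul_comm, Nat.div_add_mod, ← Bool.eq_iff_iff] at this
  · have hpow : 2 ^ (n * r) ≤ 2 ^ j := Nat.pow_le_pow_right (by norm_num) (by omega)
    rw [Nat.testBit_lt_two_pow (hi.trans_le hpow), Nat.testBit_lt_two_pow (hi'.trans_le hpow)]

/-! ### The decision procedure -/

section Procedure

variable (x : List Bool) (s r n w P : ℕ)

/-- The state `q` is an entry of one of the tables in `x`, for neighbor sets that are contained in
the set of states represented by `S`. -/
def NextState (S q : ℕ) : Prop :=
  ∃ a < s, ∃ i < P, (∀ k < r, ∀ j < n, i.testBit (k * n + j) = true → S.testBit j = true) ∧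
    NumAt x w (entryPos s r n w P a i) q

/-- A number up to `P` whose first `n` binary digits are given by the predicate `p`. -/
noncomputable def maskOf (p : ℕ → Prop) : ℕ :=
  @Nat.findGreatest (fun S => ∀ q < n, (S.testBit q = true ↔ p q))
    (fun _ => Classical.propDecidable _) P

/-- The number that represents the set of states reachable at time `t`. -/
noncomputable def maskAt (t : ℕ) : ℕ :=
  Nat.rec (maskOf n P fun q => NumAt x w (initPos s r n) q)
    (fun _ m => maskOf n P fun q => NextState x s r n w P m q) t

/-- The number `w` of bits of a state and the number `P` of entries of a table are right. -/
def SizesOk : Prop :=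
  n / 2 ^ w = 0 ∧ (∀ i < w, 0 < n / 2 ^ i) ∧ P / 2 ^ (n * r) = 1 ∧ (P - 1) / 2 ^ (n * r) = 0

/-- The word `x` encodes a forgetful automaton with the given parameters. -/
def WellFormed : Prop :=
  0 < s ∧ 0 < r ∧ SizesOk r n w P ∧ Header x s r n w P ∧
    (∃ q < n, NumAt x w (initPos s r n) q) ∧
    ∀ a < s, ∀ i < P, ∃ q < n, NumAt x w (entryPos s r n w P a i) q

/-- An accepting state is reachable. -/
def Accepting : Prop :=
  ∃ t < P, ∃ q < n,
    (maskAt x s r n w P t).testBit q = true ∧ x[initPos s r n + w + q]? = some true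

end Procedure

/-- The definition uses only right shifts, so candidates can be tested without computing 2^(nr),
which may be huge for wrong parameters. -/
theorem sizesOk_iff {r n w P : ℕ} : SizesOk r n w P ↔ w = n.size ∧ P = 2 ^ (n * r) := by
  have hpos := Nat.two_pow_pos (n * r)
  unfold SizesOk
  constructor
  · rintro ⟨h₁, h₂, h₃, h₄⟩
    refine ⟨le_antisymm ?_ ?_, ?_⟩
    · by_contra hlt
      have := h₂ n.size (by omega)
      rw [Nat.div_eq_of_lt (Nat.lt_size_self n)] at this
      omega
    · refine Nat.size_le.2 ?_
      rcases (Nat.div_eq_zero_iff).1 h₁ with h | h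
      · have := Nat.two_pow_pos w
        omega
      · exact h
    · have h₅ : 2 ^ (n * r) ≤ P := by
        by_contra hlt
        rw [Nat.div_eq_of_lt (by omega)] at h₃
        omega
      rcases (Nat.div_eq_zero_iff).1 h₄ with h | h <;> omega
  · rintro ⟨rfl, rfl⟩
    refine ⟨Nat.div_eq_of_lt (Nat.lt_size_self n), fun i hi => ?_, Nat.div_self hpos,
      Nat.div_eq_of_lt (by omega)⟩
    exact Nat.div_pos (Nat.lt_size.1 hi) (Nat.two_pow_pos i)

/-- The search up to P succeeds because all n-bit numbers are in its range. Digits from n on are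
arbitrary, but they are never read. -/
theorem testBit_maskOf {n P q : ℕ} {p : ℕ → Prop} (hP : 2 ^ n ≤ P) (hq : q < n) :
    (maskOf n P p).testBit q = true ↔ p q := by
  obtain ⟨S, hS, h⟩ := exists_testBit_iff n p
  let _ : DecidablePred fun S : ℕ => ∀ q < n, (S.testBit q = true ↔ p q) :=
    fun _ => Classical.propDecidable _
  exact Nat.findGreatest_spec (P := fun S => ∀ q < n, (S.testBit q = true ↔ p q))
    (hS.le.trans hP) h q hq

theorem maskOf_le {n P : ℕ} {p : ℕ → Prop} : maskOf n P p ≤ P := by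
  let _ : DecidablePred fun S : ℕ => ∀ q < n, (S.testBit q = true ↔ p q) :=
    fun _ => Classical.propDecidable _
  exact Nat.findGreatest_le P

theorem lt_two_pow_size {n : ℕ} (q : Fin n) : (q : ℕ) < 2 ^ n.size :=
  q.2.trans (Nat.lt_size_self n)

/-- The numbers `maskAt` represent the sets of reachable states. -/
theorem testBit_maskAt_iff {s r n : ℕ} (hr : 0 < r) {A : DistributedAutomaton (Fin s) r (Fin n)}
    {x : List Bool} (hx : encode A = x) (t : ℕ) (q : Fin n) :
    (maskAt x s r n n.size (2 ^ (n * r)) t).testBit q = true ↔ q ∈ A.reachSet t := by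
  obtain ⟨-, hinit, -, htab⟩ := encode_eq_iff.1 hx
  have hP : 2 ^ n ≤ 2 ^ (n * r) :=
    Nat.pow_le_pow_right (by norm_num) (Nat.le_mul_of_pos_right n hr)
  have huniq : ∀ {p : ℕ} {q' : Fin n}, NumAt x n.size p q' → (NumAt x n.size p q ↔ q' = q) := by
    intro p q' h
    constructor
    · exact fun h' => Fin.ext (h.unique h' (lt_two_pow_size _) (lt_two_pow_size _))
    · rintro rfl
      exact h
  induction t generalizing q with
  | zero =>
    refine (testBit_maskOf hP q.2).trans ((huniq hinit).trans ?_)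
    exact eq_comm.trans Set.mem_singleton_iff.symm
  | succ t ih =>
    refine (testBit_maskOf hP q.2).trans ?_
    change NextState x s r n n.size (2 ^ (n * r)) (maskAt x s r n n.size (2 ^ (n * r)) t) q ↔ _
    -- The fact `huniq` depends on q, so the induction hypothesis carries it as a premise, which is
    -- proved again for the state j.
    have ih' : ∀ j (hj : j < n), (maskAt x s r n n.size (2 ^ (n * r)) t).testBit j = true ↔
        (⟨j, hj⟩ : Fin n) ∈ A.reachSet t := fun j hj => ih ⟨j, hj⟩ (fun h => by
          constructor
          · exact fun h' => Fin.ext (h.unique h' (lt_two_pow_size _) (lt_two_pow_size _))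
          · rintro rfl
            exact h)
    constructor
    · rintro ⟨a, ha, i, hi, hN, hq⟩
      refine ⟨⟨a, ha⟩, neighborSets n r i, fun k j hj => ?_, (huniq (htab ⟨a, ha⟩ i hi)).1 hq⟩
      exact (ih' j j.2).1 (hN k k.2 j j.2 hj)
    · rintro ⟨a, N, hN, hq⟩
      obtain ⟨i, hi, rfl⟩ := exists_neighborSets_eq N
      exact ⟨a, a.2, i, hi, fun k hk j hj h => (ih' j hj).2 (hN ⟨k, hk⟩ h),
        (huniq (htab a i hi)).2 hq⟩

theorem accepting_iff {s r n : ℕ} (hs : 0 < s) (hr : 0 < r)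
    {A : DistributedAutomaton (Fin s) r (Fin n)} (hA : A.IsForgetful) {x : List Bool}
    (hx : encode A = x) :
    Accepting x s r n n.size (2 ^ (n * r)) ↔ A.language.Nonempty := by
  have : Nonempty (Fin s) := ⟨⟨0, hs⟩⟩
  have hacc := (encode_eq_iff.1 hx).2.2.1
  have hP : 2 ^ n ≤ 2 ^ (n * r) :=
    Nat.pow_le_pow_right (by norm_num) (Nat.le_mul_of_pos_right n hr)
  constructor
  · rintro ⟨t, -, q, hq, h₁, h₂⟩
    obtain ⟨P, hP⟩ := A.exists_run_eq hA t ((testBit_maskAt_iff hr hx t ⟨q, hq⟩).1 h₁)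
    exact ⟨P, t, by rw [hP]; exact (hacc ⟨q, hq⟩).1 h₂⟩
  · intro h
    obtain ⟨t, ht, q, h₁, h₂⟩ := (A.language_nonempty_iff hA).1 h
    exact ⟨t, ht.trans_le hP, q, q.2, (testBit_maskAt_iff hr hx t q).2 h₁, (hacc q).2 h₂⟩

/-- Every well-formed word is the encoding of a forgetful automaton. -/
theorem WellFormed.exists_encode_eq {x : List Bool} {s r n w P : ℕ}
    (h : WellFormed x s r n w P) :
    ∃ A : DistributedAutomaton (Fin s) r (Fin n), A.IsForgetful ∧ encode A = x := by
  obtain ⟨-, -, hsz, hhead, ⟨q₀, hq₀, hinit⟩, htab⟩ := h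
  obtain ⟨rfl, rfl⟩ := sizesOk_iff.1 hsz
  choose i hi hN using exists_neighborSets_eq (n := n) (r := r)
  choose q hqn hq using htab
  refine ⟨⟨⟨q₀, hq₀⟩, fun a _ N => ⟨q a a.2 (i N) (hi N), hqn _ _ _ _⟩,
    {p | x[initPos s r n + n.size + p]? = some true}⟩, fun a p p' N => rfl, ?_⟩
  refine encode_eq_iff.2 ⟨hhead, hinit, fun p => Iff.rfl, fun a j hj => ?_⟩
  -- The index chosen for `neighborSets n r j` is j itself by injectivity; generalizing it to i'
  -- permits the substitution although q depends on a proof of the index bound.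
  have key : ∀ i' (hi' : i' < 2 ^ (n * r)), i' = j →
      NumAt x n.size (entryPos s r n n.size (2 ^ (n * r)) a j) (q a a.2 i' hi') := by
    rintro i' hi' rfl
    exact hq a a.2 _ hi'
  exact key _ _ (neighborSets_injOn (hi _) hj (hN _))

theorem wellFormed_encode {s r n : ℕ} (hs : 0 < s) (hr : 0 < r)
    (A : DistributedAutomaton (Fin s) r (Fin n)) :
    WellFormed (encode A) s r n n.size (2 ^ (n * r)) := by
  obtain ⟨h₁, h₂, h₃, h₄⟩ := encode_eq_iff.1 (rfl : encode A = encode A)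
  exact ⟨hs, hr, sizesOk_iff.2 ⟨rfl, rfl⟩, h₁, ⟨_, A.init.2, h₂⟩,
    fun a ha i hi => ⟨_, Fin.isLt _, h₄ ⟨a, ha⟩ i hi⟩⟩

/-- The tables occupy s · 2^(nr) · w bits with s, w > 0, so even 2^(nr) is at most |x| and all five
parameters can be found by bounded search. An empty alphabet is excluded because a pointed digraph
has a labeled node. -/
theorem mem_forgetfulEmptinessProblem_iff (x : List Bool) :
    x ∈ ForgetfulEmptinessProblem ↔
      ∃ s < x.length + 1, ∃ r < x.length + 1, ∃ n < x.length + 1, ∃ w < x.length + 1,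
        ∃ P < x.length + 1, WellFormed x s r n w P ∧ Accepting x s r n w P := by
  constructor
  · rintro ⟨s, r, n, A, hr, hA, hne, rfl⟩
    have hs : 0 < s := by
      obtain ⟨P, -⟩ := hne
      exact (P.graph.label P.point).pos
    have hn : 0 < n := A.init.pos
    have hw : 0 < n.size := Nat.size_pos.2 hn
    have hwf := wellFormed_encode hs hr A
    have hlen := hwf.2.2.2.1.1
    have hP : 2 ^ (n * r) ≤ s * (2 ^ (n * r) * n.size) :=
      (Nat.le_mul_of_pos_right _ hw).trans (Nat.le_mul_of_pos_left _ hs)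
    unfold initPos at hlen
    exact ⟨s, by omega, r, by omega, n, by omega, n.size, by omega, 2 ^ (n * r), by omega, hwf,
      (accepting_iff hs hr hA rfl).2 hne⟩
  · rintro ⟨s, -, r, -, n, -, w, -, P, -, hwf, hacc⟩
    obtain ⟨A, hA, hx⟩ := hwf.exists_encode_eq
    obtain ⟨rfl, rfl⟩ := sizesOk_iff.1 hwf.2.2.1
    exact ⟨s, r, n, A, hwf.2.1, hA, (accepting_iff hwf.1 hwf.2.1 hA hx).1 hacc, hx⟩

/-! ### The decision procedure in logarithmic space -/

section Closure

variable {Γ : Type} [Ctx Γ] {s r n w P : List Bool → Γ → ℕ}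

theorem LSP.numAt {p q : List Bool → Γ → ℕ} (hw : LS w) (hp : LS p) (hq : LS q) :
    LSP fun x γ => NumAt x (w x γ) (p x γ) (q x γ) :=
  LSP.forall_lt (P := fun x γ j => x[p x γ + j]? = some true ↔ (q x γ).testBit j = true) hw
    ((LSP.bit (hp.weaken.add .last)).iff (LSP.testBit hq.weaken .last))

theorem LS.initPos (hs : LS s) (hr : LS r) (hn : LS n) :
    LS fun x γ => initPos (s x γ) (r x γ) (n x γ) :=
  (hs.succ.add hr.succ).add hn.succ

theorem LS.entryPos (hs : LS s) (hr : LS r) (hn : LS n) (hw : LS w) (hP : LS P)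
    {a i : List Bool → Γ → ℕ} (ha : LS a) (hi : LS i) :
    LS fun x γ => entryPos (s x γ) (r x γ) (n x γ) (w x γ) (P x γ) (a x γ) (i x γ) :=
  ((((LS.initPos hs hr hn).add hw).add hn).add (ha.mul (hP.mul hw))).add (hi.mul hw)

theorem LSP.allTrue {p m : List Bool → Γ → ℕ} (hp : LS p) (hm : LS m) :
    LSP fun x γ => ∀ i < m x γ, x[p x γ + i]? = some true :=
  LSP.forall_lt hm (LSP.bit (hp.weaken.add .last))

theorem LSP.header (hs : LS s) (hr : LS r) (hn : LS n) (hw : LS w) (hP : LS P) :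
    LSP fun x γ => Header x (s x γ) (r x γ) (n x γ) (w x γ) (P x γ) := by
  refine (LSP.eq .length ((((LS.initPos hs hr hn).add hw).add hn).add (hs.mul (hP.mul hw)))).and ?_
  refine LSP.and (LSP.forall_lt hs (LSP.bit .last)) ((LSP.bit hs).not.and ?_)
  refine LSP.and (LSP.allTrue hs.succ hr) ((LSP.bit (hs.succ.add hr)).not.and ?_)
  exact LSP.and (LSP.allTrue (hs.succ.add hr.succ) hn)
    (LSP.bit ((hs.succ.add hr.succ).add hn)).not

theorem LSP.sizesOk (hr : LS r) (hn : LS n) (hw : LS w) (hP : LS P) :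
    LSP fun x γ => SizesOk (r x γ) (n x γ) (w x γ) (P x γ) :=
  (LSP.eq (hn.div_two_pow hw) (.const 0)).and
    ((LSP.forall_lt hw (LSP.pos (hn.weaken.div_two_pow .last))).and
      ((LSP.eq (hP.div_two_pow (hn.mul hr)) (.const 1)).and
        (LSP.eq (hP.pred.div_two_pow (hn.mul hr)) (.const 0))))

theorem LSP.wellFormed (hs : LS s) (hr : LS r) (hn : LS n) (hw : LS w) (hP : LS P) :
    LSP fun x γ => WellFormed x (s x γ) (r x γ) (n x γ) (w x γ) (P x γ) := by
  refine (LSP.pos hs).and ((LSP.pos hr).and ((LSP.sizesOk hr hn hw hP).and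
    ((LSP.header hs hr hn hw hP).and (LSP.and ?_ ?_))))
  · exact LSP.exists_lt hn (LSP.numAt hw.weaken (LS.initPos hs hr hn).weaken .last)
  · exact LSP.forall_lt (P := fun x γ a => ∀ i < P x γ, ∃ q < n x γ, NumAt x (w x γ)
      (DistAut.entryPos (s x γ) (r x γ) (n x γ) (w x γ) (P x γ) a i) q) hs
      (LSP.forall_lt (P := fun x γ i => ∃ q < n x γ.1, NumAt x (w x γ.1)
        (DistAut.entryPos (s x γ.1) (r x γ.1) (n x γ.1) (w x γ.1) (P x γ.1) γ.2 i) q) hP.weaken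
      (LSP.exists_lt (P := fun x γ q => NumAt x (w x γ.1.1) (DistAut.entryPos (s x γ.1.1)
        (r x γ.1.1) (n x γ.1.1) (w x γ.1.1) (P x γ.1.1) γ.1.2 γ.2) q) hn.weaken.weaken
      (LSP.numAt hw.weaken.weaken.weaken (LS.weaken (LS.entryPos hs.weaken.weaken hr.weaken.weaken
        hn.weaken.weaken hw.weaken.weaken hP.weaken.weaken LS.last.weaken .last)) .last)))

theorem LSP.nextState (hs : LS s) (hr : LS r) (hn : LS n) (hw : LS w) (hP : LS P)
    {S q : List Bool → Γ → ℕ} (hS : LS S) (hq : LS q) :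
    LSP fun x γ => NextState x (s x γ) (r x γ) (n x γ) (w x γ) (P x γ) (S x γ) (q x γ) := by
  refine LSP.exists_lt (P := fun x γ a => ∃ i < P x γ, (∀ k < r x γ, ∀ j < n x γ,
    i.testBit (k * n x γ + j) = true → (S x γ).testBit j = true) ∧ NumAt x (w x γ)
    (DistAut.entryPos (s x γ) (r x γ) (n x γ) (w x γ) (P x γ) a i) (q x γ)) hs ?_
  refine LSP.exists_lt (P := fun x γ i => (∀ k < r x γ.1, ∀ j < n x γ.1,
    i.testBit (k * n x γ.1 + j) = true → (S x γ.1).testBit j = true) ∧ NumAt x (w x γ.1)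
    (DistAut.entryPos (s x γ.1) (r x γ.1) (n x γ.1) (w x γ.1) (P x γ.1) γ.2 i) (q x γ.1))
    hP.weaken ?_
  refine LSP.and ?_ (LSP.numAt hw.weaken.weaken (LS.entryPos hs.weaken.weaken hr.weaken.weaken
    hn.weaken.weaken hw.weaken.weaken hP.weaken.weaken LS.last.weaken .last) hq.weaken.weaken)
  refine LSP.forall_lt (P := fun x γ k => ∀ j < n x γ.1.1,
    γ.2.testBit (k * n x γ.1.1 + j) = true → (S x γ.1.1).testBit j = true) hr.weaken.weaken ?_
  refine LSP.forall_lt (P := fun x γ j =>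
    γ.1.2.testBit (γ.2 * n x γ.1.1.1 + j) = true → (S x γ.1.1.1).testBit j = true)
    hn.weaken.weaken.weaken ?_
  exact (LSP.testBit LS.last.weaken.weaken ((LS.last.weaken.mul
    hn.weaken.weaken.weaken.weaken).add .last)).imp (LSP.testBit hS.weaken.weaken.weaken.weaken .last)

theorem LS.maskOf {p : List Bool → Γ → ℕ → Prop} (hn : LS n) (hP : LS P)
    (hp : LSP fun x (γ : (Γ × ℕ) × ℕ) => p x γ.1.1 γ.2) :
    LS fun x γ => maskOf (n x γ) (P x γ) (p x γ) :=
  LS.findGreatest (P := fun x γ S => ∀ q < n x γ, (S.testBit q = true ↔ p x γ q)) hP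
    (LSP.forall_lt (P := fun x γ q => (γ.2.testBit q = true ↔ p x γ.1 q)) hn.weaken
      ((LSP.testBit LS.last.weaken .last).iff hp))

/-- Only the current mask is stored from one time step to the next; by `maskOf_le` it never exceeds
P, as bounded recursion requires. This holds for arbitrary parameters, even if x is not an encoding.
-/
theorem LS.maskAt (hs : LS s) (hr : LS r) (hn : LS n) (hw : LS w) (hP : LS P)
    {t : List Bool → Γ → ℕ} (ht : LS t) :
    LS fun x γ => maskAt x (s x γ) (r x γ) (n x γ) (w x γ) (P x γ) (t x γ) := by
  refine LS.natRec (f := fun x γ _ m => DistAut.maskOf (n x γ) (P x γ)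
    fun q => NextState x (s x γ) (r x γ) (n x γ) (w x γ) (P x γ) m q)
    ht ?_ ?_ hP.1 fun x γ i _ => ?_
  · exact LS.maskOf hn hP (LSP.numAt hw.weaken.weaken (LS.initPos hs hr hn).weaken.weaken .last)
  · exact LS.maskOf hn.weaken.weaken hP.weaken.weaken
      (LSP.nextState hs.weaken.weaken.weaken.weaken hr.weaken.weaken.weaken.weaken
        hn.weaken.weaken.weaken.weaken hw.weaken.weaken.weaken.weaken hP.weaken.weaken.weaken.weaken
        LS.last.weaken.weaken .last)
  · cases i <;> exact maskOf_le

theorem LSP.accepting (hs : LS s) (hr : LS r) (hn : LS n) (hw : LS w) (hP : LS P) :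
    LSP fun x γ => Accepting x (s x γ) (r x γ) (n x γ) (w x γ) (P x γ) := by
  refine LSP.exists_lt (P := fun x γ t => ∃ q < n x γ,
    (DistAut.maskAt x (s x γ) (r x γ) (n x γ) (w x γ) (P x γ) t).testBit q = true ∧
      x[DistAut.initPos (s x γ) (r x γ) (n x γ) + w x γ + q]? = some true) hP ?_
  refine LSP.exists_lt (P := fun x γ q =>
    (DistAut.maskAt x (s x γ.1) (r x γ.1) (n x γ.1) (w x γ.1) (P x γ.1) γ.2).testBit q = true ∧
      x[DistAut.initPos (s x γ.1) (r x γ.1) (n x γ.1) + w x γ.1 + q]? = some true) hn.weaken ?_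
  exact (LSP.testBit (LS.weaken (LS.maskAt hs.weaken hr.weaken hn.weaken hw.weaken hP.weaken .last))
    .last).and (LSP.bit (((LS.initPos hs hr hn).add hw).weaken.weaken.add .last))

end Closure

theorem lsp_forgetfulEmptinessProblem :
    LSP fun x (_ : Unit) => x ∈ ForgetfulEmptinessProblem := by
  refine LSP.congr ?_ fun x _ => (mem_forgetfulEmptinessProblem_iff x).symm
  have hlen : ∀ {Γ : Type} [Ctx Γ], LS fun x (_ : Γ) => x.length + 1 := LS.length.succ
  refine LSP.exists_lt hlen (LSP.exists_lt hlen (LSP.exists_lt hlen (LSP.exists_lt hlen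
    (LSP.exists_lt hlen (LSP.and ?_ ?_)))))
  · exact LSP.wellFormed LS.last.weaken.weaken.weaken.weaken LS.last.weaken.weaken.weaken
      LS.last.weaken.weaken LS.last.weaken .last
  · exact LSP.accepting LS.last.weaken.weaken.weaken.weaken LS.last.weaken.weaken.weaken
      LS.last.weaken.weaken LS.last.weaken .last

end DistAut

theorem mainTheorem4 : DistAut.InLogSpace DistAut.ForgetfulEmptinessProblem :=
  DistAut.lsp_forgetfulEmptinessProblem.inLogSpace
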